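/- Let $n\ge 1$, $\alpha\in(0,1)$, and put $\mu_{n,\alpha}=2^{\alpha}\pi^{-n/2}\,\Gamma\!\left(\frac{n+\alpha+1}{2}\right)/\Gamma\!\left(\frac{1-\alpha}{2}\right)$. For functions $f,g:\mathbb R^n\to\mathbb R$ and vector fields $\phi:\mathbb R^n\to\mathbb R^n$ set, whenever the integrals converge absolutely, $$\nabla^\alpha f(x)=\mu_{n,\alpha}\int_{\mathbb R^n}\frac{(y-x)(f(y)-f(x))}{|y-x|^{n+\alpha+1}}\,dy,\qquad \operatorname{div}^\alpha\phi(x)=\mu_{n,\alpha}\int_{\mathbb R^n}\frac{(y-x)\cdot(\phi(y)-\phi(x))}{|y-x|^{n+\alpha+1}}\,dy,$$ $$\nabla^\alpha_{\rm NL}(f,g)(x)=\mu_{n,\alpha}\int_{\mathbb R^n}\frac{(y-x)(f(y)-f(x))(g(y)-g(x))}{|y-x|^{n+\alpha+1}}\,dy.$$ For $p\in[1,\infty]$, $BV^{\alpha,p}(\mathbb R^n)$ is the set of $f\in L^p(\mathbb R^n)$ with $$\sup\Big\{\int_{\mathbb R^n} f\operatorname{div}^\alpha\phi\,dx:\ \phi\in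 C^\infty_c(\mathbb R^n;\mathbb R^n),\ \|\phi\|_\infty\le 1\Big\}<\infty,$$ and for such $f$ the fractional variation measure $D^\alpha f$ is the finite $\mathbb R^n$-valued Radon measure with $\int f\operatorname{div}^\alpha\phi\,dx=-\int\phi\cdot dD^\alpha f$ for all $\phi\in C^\infty_c(\mathbb R^n;\mathbb R^n)$. For $q\in[1,\infty]$, $B^\alpha_{q,1}(\mathbb R^n)$ is the set of $g\in L^q(\mathbb R^n)$ with $\int_{\mathbb R^n}\|g(\cdot+h)-g\|_{L^q}\,|h|^{-n-\alpha}\,dh<\infty$, and $C_b(\mathbb R^n)$ is the space of bounded continuous functions. **Theorem.** Let $p,q\in[1,\infty]$ with $\frac1p+\frac1q=1$, let $f\in BV^{\alpha,p}(\mathbb R^n)$ and $g\in C_b(\mathbb R^n)\cap B^\alpha_{q,1}(\mathbb R^n)$. Then $fg\in BV^{\alpha,r}(\mathbb R^n)$ for all $r\in[1,p]$. The measures $D^\alpha f$ and $D^\alpha(fg)$ exist, the integrals defining $\nabla^\alpha g(x)$ and $\nabla^\alpha_{\rm NL}(f,g)(x)$ converge absolutely for a.e. $x$, the function $g$ is $|D^\alpha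 f|$-integrable, the functions $f\,\nabla^\alpha g$ and $\nabla^\alpha_{\rm NL}(f,g)$ are in $L^1(\mathbb R^n;\mathbb R^n)$, and, as finite $\mathbb R^n$-valued Radon measures, $$D^\alpha(fg)=g\,D^\alpha f+f\,\nabla^\alpha g\,\mathscr L^n+\nabla^\alpha_{\rm NL}(f,g)\,\mathscr L^n .$$ In addition, $$D^\alpha(fg)(\mathbb R^n)=0,\qquad \int_{\mathbb R^n}\nabla^\alpha_{\rm NL}(f,g)\,dx=0,\qquad \int_{\mathbb R^n}f\,\nabla^\alpha g\,dx=-\int_{\mathbb R^n}g\,dD^\alpha f .$$ -/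

import Mathlib

open MeasureTheory
open scoped ENNReal ContDiff

noncomputable section

namespace FracBV

/-- `ℝⁿ` with its Euclidean structure. -/
abbrev Rn (n : ℕ) : Type := EuclideanSpace ℝ (Fin n)

variable {n : ℕ}

/-- The normalizing constant `μ_{n,α} = 2^α π^{-n/2} Γ((n+α+1)/2) / Γ((1-α)/2)`. -/
def fracConst (n : ℕ) (α : ℝ) : ℝ :=
  2 ^ α * Real.pi ^ (-(n : ℝ) / 2) *
    (Real.Gamma (((n : ℝ) + α + 1) / 2) / Real.Gamma ((1 - α) / 2))

/-- The integrand `(y-x)(f(y)-f(x)) / |y-x|^{n+α+1}` of the fractional gradient at `x`. -/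
def gradKernel (α : ℝ) (f : Rn n → ℝ) (x y : Rn n) : Rn n :=
  ((f y - f x) / ‖y - x‖ ^ ((n : ℝ) + α + 1)) • (y - x)

/-- The integrand `(y-x)(f(y)-f(x))(g(y)-g(x)) / |y-x|^{n+α+1}` of the non-local fractional
gradient at `x`. -/
def gradNLKernel (α : ℝ) (f g : Rn n → ℝ) (x y : Rn n) : Rn n :=
  ((f y - f x) * (g y - g x) / ‖y - x‖ ^ ((n : ℝ) + α + 1)) • (y - x)

/-- The fractional gradient `∇^α f`. -/
def fracGrad (α : ℝ) (f : Rn n → ℝ) (x : Rn n) : Rn n :=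
  fracConst n α • ∫ y, gradKernel α f x y

/-- The non-local fractional gradient `∇^α_NL(f, g)`. -/
def fracGradNL (α : ℝ) (f g : Rn n → ℝ) (x : Rn n) : Rn n :=
  fracConst n α • ∫ y, gradNLKernel α f g x y

/-- The fractional divergence `div^α φ`. -/
def fracDiv (α : ℝ) (φ : Rn n → Rn n) (x : Rn n) : ℝ :=
  fracConst n α *
    ∫ y, inner ℝ (y - x) (φ y - φ x) / ‖y - x‖ ^ ((n : ℝ) + α + 1)

/-- The fractional variation `|D^α f|(ℝⁿ)`: the supremum of `∫ f div^α φ` over smooth compactly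
supported vector fields `φ` with `‖φ‖_∞ ≤ 1`. (The competitor `φ = 0` gives the value `0`, so
nothing is lost by taking the supremum in `[0, ∞]`.) -/
def fracVariation (α : ℝ) (f : Rn n → ℝ) : ℝ≥0∞ :=
  ⨆ (φ : Rn n → Rn n) (_ : ContDiff ℝ ∞ φ) (_ : HasCompactSupport φ) (_ : ∀ x, ‖φ x‖ ≤ 1),
    ENNReal.ofReal (∫ x, f x * fracDiv α φ x)

/-- `f ∈ BV^{α,p}(ℝⁿ)`. -/
def MemBV (α : ℝ) (p : ℝ≥0∞) (f : Rn n → ℝ) : Prop :=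
  MemLp f p ∧ fracVariation α f < ⊤

/-- The finite `ℝⁿ`-valued Borel (hence Radon) measure `ν` is a fractional variation measure of
`f`: `∫ f div^α φ dx = - ∫ φ · dν` for all smooth compactly supported vector fields `φ`. -/
def IsFracVarMeasure (α : ℝ) (f : Rn n → ℝ) (ν : VectorMeasure (Rn n) (Rn n)) : Prop :=
  IsFiniteMeasure ν.variation ∧
    ∀ φ : Rn n → Rn n, ContDiff ℝ ∞ φ → HasCompactSupport φ →
      ∫ x, f x * fracDiv α φ x = - ν.integral φ (innerSL ℝ)

open scoped Classical in
/-- The fractional variation measure `D^α f` (with the value `0` if there is none). -/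
def fracD (α : ℝ) (f : Rn n → ℝ) : VectorMeasure (Rn n) (Rn n) :=
  if h : ∃ ν, IsFracVarMeasure α f ν then h.choose else 0

/-- The Besov seminorm `[u]_{B^α_{p,s}(ℝⁿ)}`. -/
def besovSeminorm (α : ℝ) (p s : ℝ≥0∞) (u : Rn n → ℝ) : ℝ≥0∞ :=
  if s = ⊤ then
    ⨆ (h : Rn n) (_ : h ≠ 0),
      eLpNorm (fun x => u (x + h) - u x) p / ENNReal.ofReal (‖h‖ ^ α)
  else
    (∫⁻ h : Rn n, eLpNorm (fun x => u (x + h) - u x) p ^ s.toReal /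
      ENNReal.ofReal (‖h‖ ^ ((n : ℝ) + s.toReal * α))) ^ (1 / s.toReal)

/-- `u ∈ B^α_{p,s}(ℝⁿ)`. -/
def MemBesov (α : ℝ) (p s : ℝ≥0∞) (u : Rn n → ℝ) : Prop :=
  MemLp u p ∧ besovSeminorm α p s u < ⊤

/-- `u ∈ C_b(ℝⁿ)`. -/
def MemCb (u : Rn n → ℝ) : Prop :=
  Continuous u ∧ ∃ C : ℝ, ∀ x, |u x| ≤ C

end FracBV

end

/-! ### Vector measures with a density: integration, polar form, uniqueness -/

section VectorMeasureDensity

open VectorMeasure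

variable {X E F G : Type*} {mX : MeasurableSpace X}
  [NormedAddCommGroup E] [NormedSpace ℝ E]
  [NormedAddCommGroup F] [NormedSpace ℝ F] [CompleteSpace F]
  [NormedAddCommGroup G] [NormedSpace ℝ G]
  {m : Measure X} {σ : X → F} {φ ψ : X → E}

namespace FracBV

/-! After the substitution y = x + h every operator is an integral of increments against the odd
kernel K(h) = h/|h|^{n+α+1}, with |K(h)| = |h|^{-n-α}. Hölder in x for fixed h, then integration in
h, bounds ∬ |F(x)| |u(x+h) - u(x)| |h|^{-n-α} by ‖F‖_p times the Besov seminorm of u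
(`lintegral_increment_le`). So all the double integrals converge absolutely and Fubini applies.

The Leibniz rule is then algebra plus a symmetry. Tested against φ, and writing f', g', φ' for
values at x + h, the difference of its two sides is the integral of K(h)·(g - g')(f φ' - f' φ). The
involution (x, h) ↦ (x + h, -h) preserves measure and reverses the sign of this integrand, so the
integral vanishes (`divPairing_mul`). The same symmetry gives ∇^α_NL(f, g) mean zero.

In this identity D^α f is tested against gφ, which is only continuous, compactly supported and
Besov; mollification extends the defining formula to such fields
(`divPairing_eq_integral_of_continuous`). Hence the right-hand side of the Leibniz rule is a
fractional variation measure of fg, and uniqueness identifies it with D^α(fg).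

Existence of D^α f comes from Hahn–Banach and a signed Riesz theorem (`exists_isFracVarMeasure`),
uniqueness from the density of a vector measure with respect to its variation
(`IsFracVarMeasure.eq`). Since fg is in L^1, testing with cutoffs increasing to the whole space
gives D^α(fg) zero total mass (`univ_eq_zero_of_isFracVarMeasure`). Evaluating the Leibniz rule on
the whole space then yields the integration by parts formula. -/

theorem integrable_variation_withDensityᵥ_iff (hσ : Integrable σ m) :
    (m.withDensityᵥ σ).Integrable φ ↔ Integrable (fun x => ‖σ x‖ • φ x) m := by
  rw [VectorMeasure.Integrable, Measure.variation_withDensityᵥ hσ,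
    integrable_withDensity_iff_integrable_smul₀' hσ.aestronglyMeasurable.enorm (by simp)]
  simp

/-- The variation is |σ| m, so φ and ψ may differ on {σ = 0}; there both sides are 0. -/
theorem bilin_congr_ae_of_variation (hσ : Integrable σ m) (B : E →L[ℝ] F →L[ℝ] G)
    (h : φ =ᵐ[(m.withDensityᵥ σ).variation] ψ) :
    (fun x => B (φ x) (σ x)) =ᵐ[m] fun x => B (ψ x) (σ x) := by
  rw [Measure.variation_withDensityᵥ hσ] at h
  have h' := (ae_withDensity_iff' hσ.aestronglyMeasurable.enorm).1 h
  filter_upwards [h'] with x hx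
  by_cases h0 : σ x = 0
  · simp [h0]
  · rw [hx (by simpa using h0)]

theorem integrable_bilin_of_variation (hσ : Integrable σ m) (B : E →L[ℝ] F →L[ℝ] G)
    (hφ : (m.withDensityᵥ σ).Integrable φ) : Integrable (fun x => B (φ x) (σ x)) m := by
  -- φ is measurable only up to |σ| m-null sets, which need not be m-null, so a strongly measurable
  -- representative is treated first.
  have key : ∀ φ : X → E, StronglyMeasurable φ → (m.withDensityᵥ σ).Integrable φ →
      Integrable (fun x => B (φ x) (σ x)) m := by
    intro φ hm hφ
    have h1 := ((integrable_variation_withDensityᵥ_iff hσ).1 hφ).norm.const_mul ‖B‖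
    refine h1.mono' ?_ (Filter.Eventually.of_forall fun x => ?_)
    · exact B.aestronglyMeasurable_comp₂ hm.aestronglyMeasurable hσ.aestronglyMeasurable
    · refine (B.le_opNorm₂ _ _).trans (le_of_eq ?_)
      rw [norm_smul, norm_norm]; ring
  have h2 := key _ hφ.1.stronglyMeasurable_mk (hφ.congr hφ.1.ae_eq_mk)
  exact h2.congr (bilin_congr_ae_of_variation hσ B hφ.1.ae_eq_mk).symm

theorem integral_bilin_sub_le (hσ : Integrable σ m) (B : E →L[ℝ] F →L[ℝ] G)
    (hφ : (m.withDensityᵥ σ).Integrable φ) :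
    ‖∫ x, B (φ x) (σ x) ∂m‖ ≤ ‖B‖ * ∫ x, ‖φ x‖ ∂(m.withDensityᵥ σ).variation := by
  refine (norm_integral_le_integral_norm _).trans ?_
  rw [Measure.variation_withDensityᵥ hσ,
    integral_withDensity_eq_integral_toReal_smul₀ hσ.aestronglyMeasurable.enorm (by simp),
    ← integral_const_mul]
  have h1 := ((integrable_variation_withDensityᵥ_iff hσ).1 hφ).norm.const_mul ‖B‖
  refine integral_mono_ae (integrable_bilin_of_variation hσ B hφ).norm ?_
    (Filter.Eventually.of_forall fun x => ?_)
  · refine h1.congr (Filter.Eventually.of_forall fun x => ?_)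
    simp [norm_smul]
  · refine (B.le_opNorm₂ _ _).trans (le_of_eq ?_)
    simp; ring

/-- Both sides agree on indicators, are additive, and are continuous in L^1(|σ| m), the right one
being Lipschitz with constant ‖B‖. -/
theorem integral_withDensityᵥ [CompleteSpace G] (hσ : Integrable σ m) (B : E →L[ℝ] F →L[ℝ] G)
    (hφ : (m.withDensityᵥ σ).Integrable φ) :
    (m.withDensityᵥ σ).integral φ B = ∫ x, B (φ x) (σ x) ∂m := by
  refine MeasureTheory.Integrable.induction
    (P := fun φ => (m.withDensityᵥ σ).integral φ B = ∫ x, B (φ x) (σ x) ∂m) ?_ ?_ ?_ ?_ hφ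
  · intro c s hs hfin
    rw [VectorMeasure.integral_indicator hs]
    have : IsFiniteMeasure ((m.withDensityᵥ σ).variation.restrict s) := ⟨by simpa using hfin⟩
    rw [VectorMeasure.setIntegral_const, withDensityᵥ_apply hσ hs,
      ← ContinuousLinearMap.integral_comp_comm _ hσ.integrableOn, ← MeasureTheory.integral_indicator hs]
    congr 1; ext x
    by_cases hx : x ∈ s <;> simp [hx]
  · intro f g _ hf hg h1 h2
    rw [VectorMeasure.integral_add hf hg, h1, h2, ← integral_add
      (integrable_bilin_of_variation hσ B hf) (integrable_bilin_of_variation hσ B hg)]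
    simp
  · refine isClosed_eq continuous_integral ?_
    have : LipschitzWith ‖B‖₊ (fun f : X →₁[(m.withDensityᵥ σ).variation] E =>
        ∫ x, B (f x) (σ x) ∂m) := by
      refine LipschitzWith.of_dist_le_mul fun f g => ?_
      rw [dist_eq_norm, dist_eq_norm, ← integral_sub
        (integrable_bilin_of_variation hσ B (L1.integrable_coeFn f))
        (integrable_bilin_of_variation hσ B (L1.integrable_coeFn g)), L1.norm_eq_integral_norm]
      have h1 := bilin_congr_ae_of_variation hσ B (Lp.coeFn_sub f g)
      have h2 : ∫ x, B (f x) (σ x) - B (g x) (σ x) ∂m = ∫ x, B ((f - g) x) (σ x) ∂m := by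
        refine integral_congr_ae ?_
        filter_upwards [h1] with x hx
        rw [hx]; simp
      rw [h2]
      exact integral_bilin_sub_le hσ B (L1.integrable_coeFn (f - g))
    exact this.continuous
  · intro f g hfg hf h
    rw [← VectorMeasure.integral_congr_ae hfg, h]
    exact integral_congr_ae (bilin_congr_ae_of_variation hσ B hfg)

omit [CompleteSpace F] in
theorem restrict_withDensityᵥ (hσ : Integrable σ m) {s : Set X} (hs : MeasurableSet s) :
    (m.withDensityᵥ σ).restrict s = (m.restrict s).withDensityᵥ σ := by
  ext t ht
  rw [restrict_apply _ hs ht, withDensityᵥ_apply hσ (ht.inter hs),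
    withDensityᵥ_apply hσ.restrict ht, Measure.restrict_restrict ht]

theorem withDensity_withDensityᵥ (hσ : Integrable σ m) {g : X → ℝ}
    (hg : (m.withDensityᵥ σ).Integrable g) :
    (m.withDensityᵥ σ).withDensity g (ContinuousLinearMap.lsmul ℝ ℝ) =
      m.withDensityᵥ (fun x => g x • σ x) := by
  have hi := integrable_bilin_of_variation hσ (ContinuousLinearMap.lsmul ℝ ℝ) hg
  ext s hs
  have hr := hg.restrict (s := s)
  rw [VectorMeasure.withDensity_apply hg, withDensityᵥ_apply (by simpa using hi) hs]
  rw [restrict_withDensityᵥ hσ hs] at hr ⊢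
  rw [integral_withDensityᵥ hσ.restrict _ hr]
  simp

/-- Each coordinate is absolutely continuous with respect to the variation, so Radon–Nikodym applies
coordinatewise. This reduces integrals against ν to Bochner integrals. -/
theorem exists_eq_withDensityᵥ {n : ℕ} (ν : VectorMeasure X (Rn n))
    [IsFiniteMeasure ν.variation] :
    ∃ σ : X → Rn n, Integrable σ ν.variation ∧ ν = ν.variation.withDensityᵥ σ := by
  let c : Fin n → SignedMeasure X := fun i =>
    ν.mapRange (EuclideanSpace.proj (𝕜 := ℝ) i).toLinearMap.toAddMonoidHom
      (EuclideanSpace.proj (𝕜 := ℝ) i).continuous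
  have hc : ∀ i s, c i s = ν s i := fun i s => rfl
  have hac : ∀ i, c i ≪ᵥ ν.variation.toENNRealVectorMeasure := by
    intro i
    refine VectorMeasure.AbsolutelyContinuous.mk fun s hs h => ?_
    rw [Measure.toENNRealVectorMeasure_apply_measurable hs] at h
    have := enorm_measure_le_variation ν s
    rw [h] at this
    have h0 : ν s = 0 := by simpa using this
    simp [hc, h0]
  have hint : ∀ i, Integrable ((c i).rnDeriv ν.variation) ν.variation :=
    fun i => SignedMeasure.integrable_rnDeriv _ _
  have hI : Integrable (fun x => WithLp.toLp 2 (fun i => (c i).rnDeriv ν.variation x))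
      ν.variation := by
    have : Integrable (fun x => fun i => (c i).rnDeriv ν.variation x) ν.variation :=
      Integrable.of_eval hint
    exact (PiLp.continuousLinearEquiv 2 ℝ (fun _ : Fin n => ℝ)).symm.toContinuousLinearMap.integrable_comp this
  refine ⟨_, hI, ?_⟩
  ext s hs i
  rw [withDensityᵥ_apply hI hs, ← hc, ← SignedMeasure.withDensityᵥ_rnDeriv_eq _ _ (hac i),
    withDensityᵥ_apply (hint i) hs]
  exact (EuclideanSpace.proj (𝕜 := ℝ) i).integral_comp_comm hI.restrict

/-- Fields u·v with v a fixed vector show that the density of ν has zero integral against every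
smooth compactly supported u, hence vanishes almost everywhere. -/
theorem eq_zero_of_integral_test_eq_zero {n : ℕ} (ν : VectorMeasure (Rn n) (Rn n))
    [IsFiniteMeasure ν.variation]
    (h : ∀ φ : Rn n → Rn n, ContDiff ℝ ∞ φ → HasCompactSupport φ →
      ν.integral φ (innerSL ℝ) = 0) : ν = 0 := by
  obtain ⟨σ, hσ, hν⟩ := exists_eq_withDensityᵥ ν
  generalize hm : ν.variation = m at *
  have h0 : ∀ᵐ x ∂m, σ x = 0 := by
    refine ae_eq_zero_of_integral_contDiff_smul_eq_zero hσ.locallyIntegrable fun u hu hc => ?_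
    refine ext_inner_left ℝ fun v => ?_
    have h1 := h (fun x => u x • v) (hu.smul contDiff_const) hc.smul_right
    have hb : ν.Integrable (fun x => u x • v) := by
      rw [VectorMeasure.Integrable, hm]
      exact ((hu.continuous.smul continuous_const).integrable_of_hasCompactSupport hc.smul_right)
    rw [hν] at h1 hb
    rw [integral_withDensityᵥ hσ _ hb] at h1
    have hb' : Integrable (fun x => u x • σ x) m := by
      have hu' : ν.Integrable u := by
        rw [VectorMeasure.Integrable, hm]
        exact hu.continuous.integrable_of_hasCompactSupport hc
      rw [hν] at hu'
      simpa using integrable_bilin_of_variation hσ (ContinuousLinearMap.lsmul ℝ ℝ) hu'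
    rw [inner_zero_right, ← h1, ← integral_inner hb']
    congr 1; ext x
    rw [innerSL_apply_apply, inner_smul_left, inner_smul_right]; rfl
  rw [hν, WithDensityᵥEq.congr_ae (g := 0) h0, withDensityᵥ_zero]

end FracBV

end VectorMeasureDensity

/-! ### Riesz representation of bounded functionals by differences of finite measures -/

noncomputable section SignedRiesz

open NNRealRMK
open scoped NNReal BoundedContinuousFunction CompactlySupported Pointwise

namespace FracBV

noncomputable section PositivePart

variable {X : Type*} [TopologicalSpace X]

/-- The positive part of a bounded functional on `C_b(X)`, evaluated at `u ≥ 0`. -/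
def functionalPosPart (L : (X →ᵇ ℝ) →L[ℝ] ℝ) (u : X →ᵇ ℝ) : ℝ :=
  sSup (L '' Set.Icc 0 u)

variable (L : (X →ᵇ ℝ) →L[ℝ] ℝ) {u v w : X →ᵇ ℝ}

theorem abs_functional_le_of_mem_Icc (hv : v ∈ Set.Icc 0 u) : |L v| ≤ ‖L‖ * ‖u‖ := by
  refine (L.le_opNorm v).trans ?_
  gcongr
  refine (BoundedContinuousFunction.norm_le (norm_nonneg _)).2 fun x => ?_
  have h0 : 0 ≤ v x := hv.1 x
  have h1 : v x ≤ u x := hv.2 x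
  rw [Real.norm_of_nonneg h0]
  exact h1.trans ((le_abs_self _).trans (u.norm_coe_le_norm x))

theorem bddAbove_functional_image_Icc (u : X →ᵇ ℝ) : BddAbove (L '' Set.Icc 0 u) := by
  refine ⟨‖L‖ * ‖u‖, ?_⟩
  rintro _ ⟨v, hv, rfl⟩
  exact (le_abs_self _).trans (abs_functional_le_of_mem_Icc L hv)

theorem functionalPosPart_nonneg (hu : 0 ≤ u) : 0 ≤ functionalPosPart L u :=
  le_csSup (bddAbove_functional_image_Icc L u) ⟨0, ⟨le_rfl, hu⟩, map_zero L⟩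

theorem functionalPosPart_le (hu : 0 ≤ u) : functionalPosPart L u ≤ ‖L‖ * ‖u‖ := by
  refine csSup_le ⟨_, 0, ⟨le_rfl, hu⟩, rfl⟩ ?_
  rintro _ ⟨v, hv, rfl⟩
  exact (le_abs_self _).trans (abs_functional_le_of_mem_Icc L hv)

/-- Riesz decomposition: [0, u + w] = [0, u] + [0, w], splitting v as v ⊓ u plus the remainder;
suprema add over a sum of sets. -/
theorem functionalPosPart_add (hu : 0 ≤ u) (hw : 0 ≤ w) :
    functionalPosPart L (u + w) = functionalPosPart L u + functionalPosPart L w := by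
  have hI : Set.Icc 0 (u + w) = Set.Icc 0 u + Set.Icc 0 w := by
    ext v
    constructor
    · rintro ⟨h0, h1⟩
      refine Set.mem_add.2 ⟨v ⊓ u, ⟨le_inf h0 hu, inf_le_right⟩, v - v ⊓ u,
        ⟨sub_nonneg.2 inf_le_left, fun x => ?_⟩, by abel⟩
      have hx : v x ≤ u x + w x := h1 x
      have hwx : 0 ≤ w x := hw x
      change v x - min (v x) (u x) ≤ w x
      rcases min_cases (v x) (u x) with h | h <;> linarith [h.1, h.2]
    · intro h
      obtain ⟨a, ha, b, hb, rfl⟩ := Set.mem_add.1 h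
      exact ⟨add_nonneg ha.1 hb.1, add_le_add ha.2 hb.2⟩
  have hadd : L '' (Set.Icc 0 u + Set.Icc 0 w) = L '' Set.Icc 0 u + L '' Set.Icc 0 w :=
    Set.image_add L
  have h0 : ∀ {v : X →ᵇ ℝ}, 0 ≤ v → (L '' Set.Icc 0 v).Nonempty := fun hv =>
    ⟨_, 0, ⟨le_rfl, hv⟩, rfl⟩
  rw [functionalPosPart, hI, hadd, csSup_add (h0 hu)
    (bddAbove_functional_image_Icc L u) (h0 hw)
    (bddAbove_functional_image_Icc L w)]
  rfl

theorem functionalPosPart_smul {c : ℝ} (hc : 0 ≤ c) :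
    functionalPosPart L (c • u) = c * functionalPosPart L u := by
  rcases hc.eq_or_lt with rfl | hc
  · simp [functionalPosPart]
  have hI : Set.Icc 0 (c • u) = c • Set.Icc 0 u := by
    ext v
    rw [Set.mem_smul_set_iff_inv_smul_mem₀ hc.ne']
    constructor
    · rintro ⟨h0, h1⟩
      refine ⟨fun x => ?_, fun x => ?_⟩
      · have : 0 ≤ v x := h0 x
        change 0 ≤ c⁻¹ * v x
        positivity
      · have : v x ≤ c * u x := h1 x
        change c⁻¹ * v x ≤ u x
        rwa [inv_mul_le_iff₀ hc]
    · rintro ⟨h0, h1⟩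
      refine ⟨fun x => ?_, fun x => ?_⟩
      · have : 0 ≤ c⁻¹ * v x := h0 x
        change 0 ≤ v x
        rwa [le_inv_mul_iff₀ hc, mul_zero] at this
      · have : c⁻¹ * v x ≤ u x := h1 x
        change v x ≤ c * u x
        rwa [inv_mul_le_iff₀ hc] at this
  rw [functionalPosPart, hI, Set.image_smul_comm L c _ (fun v => map_smul L c v),
    Real.sSup_smul_of_nonneg hc.le]
  rfl

end PositivePart

noncomputable section Representation

variable {X : Type*} [TopologicalSpace X]

/-- A compactly supported nonnegative function as a bounded continuous real function. -/
def boundedOfCompactSupport (u : C_c(X, ℝ≥0)) : X →ᵇ ℝ :=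
  BoundedContinuousFunction.ofNormedAddCommGroup (fun x => (u x : ℝ)) (by fun_prop)
    (Classical.choose (((show Continuous fun x => (u x : ℝ) by fun_prop)).bounded_above_of_compact_support
      (u.hasCompactSupport.comp_left (g := fun r : ℝ≥0 => (r : ℝ)) rfl)))
    (Classical.choose_spec (((show Continuous fun x => (u x : ℝ) by fun_prop)).bounded_above_of_compact_support
      (u.hasCompactSupport.comp_left (g := fun r : ℝ≥0 => (r : ℝ)) rfl)))

@[simp]
theorem boundedOfCompactSupport_apply (u : C_c(X, ℝ≥0)) (x : X) :
    boundedOfCompactSupport u x = u x := rfl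

theorem boundedOfCompactSupport_nonneg (u : C_c(X, ℝ≥0)) : 0 ≤ boundedOfCompactSupport u :=
  fun x => (u x).2

/-- The positive part of a bounded functional, as a functional on `C_c(X, ℝ≥0)`. -/
def positiveFunctional (L : (X →ᵇ ℝ) →L[ℝ] ℝ) : C_c(X, ℝ≥0) →ₗ[ℝ≥0] ℝ≥0 where
  toFun u := ⟨functionalPosPart L (boundedOfCompactSupport u),
    functionalPosPart_nonneg L (boundedOfCompactSupport_nonneg u)⟩
  map_add' u v := by
    apply NNReal.eq
    change functionalPosPart L _ = functionalPosPart L _ + functionalPosPart L _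
    rw [← functionalPosPart_add L (boundedOfCompactSupport_nonneg u)
      (boundedOfCompactSupport_nonneg v)]
    rfl
  map_smul' c u := by
    apply NNReal.eq
    change functionalPosPart L _ = c * functionalPosPart L _
    refine Eq.trans ?_ (functionalPosPart_smul L c.2)
    rfl

/-- The reflection v ↦ u - v maps [0, u] to itself. This is the Jordan decomposition of L into
positive parts of L and -L. -/
theorem functionalPosPart_neg {L : (X →ᵇ ℝ) →L[ℝ] ℝ} {u : X →ᵇ ℝ} (hu : 0 ≤ u) :
    functionalPosPart (-L) u = functionalPosPart L u - L u := by
  apply le_antisymm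
  · refine csSup_le ⟨_, 0, ⟨le_rfl, hu⟩, rfl⟩ ?_
    rintro _ ⟨v, hv, rfl⟩
    have : L (u - v) ≤ functionalPosPart L u := le_csSup (bddAbove_functional_image_Icc L u)
      ⟨u - v, ⟨sub_nonneg.2 hv.2, sub_le_self _ hv.1⟩, rfl⟩
    rw [map_sub] at this
    change -L v ≤ _
    linarith
  · rw [sub_le_iff_le_add]
    refine csSup_le ⟨_, 0, ⟨le_rfl, hu⟩, rfl⟩ ?_
    rintro _ ⟨v, hv, rfl⟩
    have : (-L) (u - v) ≤ functionalPosPart (-L) u :=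
      le_csSup (bddAbove_functional_image_Icc (-L) u)
      ⟨u - v, ⟨sub_nonneg.2 hv.2, sub_le_self _ hv.1⟩, rfl⟩
    change -L (u - v) ≤ _ at this
    rw [map_sub] at this
    linarith

variable [T2Space X] [LocallyCompactSpace X] [MeasurableSpace X] [BorelSpace X]

/-- By inner regularity it suffices to bound compact sets; a cutoff v with 0 ≤ v ≤ 1 and v = 1 on K
gives mass at most ‖L‖. -/
theorem isFiniteMeasure_rieszMeasure_positiveFunctional (L : (X →ᵇ ℝ) →L[ℝ] ℝ) :
    IsFiniteMeasure (rieszMeasure (positiveFunctional L)) := by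
  refine ⟨lt_of_le_of_lt ?_ (ENNReal.ofReal_lt_top (r := ‖L‖))⟩
  rw [isOpen_univ.measure_eq_iSup_isCompact]
  refine iSup₂_le fun K _ => iSup_le fun hK => ?_
  obtain ⟨u, hu1, -, hc, hu⟩ := exists_continuous_one_zero_of_isCompact hK isClosed_empty
    (Set.disjoint_empty K)
  let v : C_c(X, ℝ≥0) := ⟨⟨fun x => (u x).toNNReal, by fun_prop⟩,
    hc.comp_left (g := Real.toNNReal) (by simp)⟩
  have hv : ∀ x, (v x : ℝ) = u x := fun x => Real.coe_toNNReal _ (hu x).1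
  calc rieszMeasure (positiveFunctional L) K
      = ∫⁻ x in K, 1 ∂(rieszMeasure (positiveFunctional L)) := by simp
    _ ≤ ∫⁻ x in K, v x ∂(rieszMeasure (positiveFunctional L)) := by
        refine setLIntegral_mono' hK.measurableSet fun x hx => ?_
        have : v x = 1 := NNReal.eq ((hv x).trans (hu1 hx))
        simp [this]
    _ ≤ ∫⁻ x, v x ∂(rieszMeasure (positiveFunctional L)) := setLIntegral_le_lintegral _ _
    _ = positiveFunctional L v := lintegral_rieszMeasure _ v
    _ = ENNReal.ofReal (functionalPosPart L (boundedOfCompactSupport v)) := by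
        rw [ENNReal.ofReal, Real.toNNReal_of_nonneg
          (functionalPosPart_nonneg L (boundedOfCompactSupport_nonneg v))]
        rfl
    _ ≤ ENNReal.ofReal ‖L‖ := by
        refine ENNReal.ofReal_le_ofReal ((functionalPosPart_le L
          (boundedOfCompactSupport_nonneg v)).trans (mul_le_of_le_one_right (show 0 ≤ ‖L‖ from norm_nonneg L) ?_))
        refine (BoundedContinuousFunction.norm_le zero_le_one).2 fun x => ?_
        rw [boundedOfCompactSupport_apply, hv, Real.norm_of_nonneg (hu x).1]
        exact (hu x).2

/-- The Jordan decomposition is applied to the positive and negative parts of u. Compact support is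
essential: a functional on C_b may carry mass at infinity. -/
theorem exists_measure_sub_eq_functional (L : (X →ᵇ ℝ) →L[ℝ] ℝ) :
    ∃ μ₁ μ₂ : Measure X, IsFiniteMeasure μ₁ ∧ IsFiniteMeasure μ₂ ∧
      ∀ u : X →ᵇ ℝ, HasCompactSupport u → L u = ∫ x, u x ∂μ₁ - ∫ x, u x ∂μ₂ := by
  refine ⟨rieszMeasure (positiveFunctional L), rieszMeasure (positiveFunctional (-L)),
    isFiniteMeasure_rieszMeasure_positiveFunctional L,
    isFiniteMeasure_rieszMeasure_positiveFunctional (-L), fun u hu => ?_⟩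
  have key : ∀ v : C_c(X, ℝ≥0), L (boundedOfCompactSupport v) =
      ∫ x, (v x : ℝ) ∂(rieszMeasure (positiveFunctional L)) -
      ∫ x, (v x : ℝ) ∂(rieszMeasure (positiveFunctional (-L))) := by
    intro v
    rw [NNRealRMK.integral_rieszMeasure, NNRealRMK.integral_rieszMeasure]
    change _ = functionalPosPart L _ - functionalPosPart (-L) _
    rw [functionalPosPart_neg (boundedOfCompactSupport_nonneg v)]
    ring
  let p : C_c(X, ℝ≥0) := ⟨⟨fun x => (u x).toNNReal, by fun_prop⟩,
    hu.comp_left (g := Real.toNNReal) (by simp)⟩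
  let q : C_c(X, ℝ≥0) := ⟨⟨fun x => (-u x).toNNReal, by fun_prop⟩,
    HasCompactSupport.comp_left (f := u) (g := fun r : ℝ => (-r).toNNReal) hu (by simp)⟩
  have hp : ∀ x, u x = p x - q x := fun x => by
    change u x = max (u x) 0 - max (-u x) 0
    rcases le_total 0 (u x) with h | h <;> simp [h]
  have hpq : u = boundedOfCompactSupport p - boundedOfCompactSupport q := by
    ext x; exact hp x
  have hi : ∀ (v : C_c(X, ℝ≥0)) (L : (X →ᵇ ℝ) →L[ℝ] ℝ),
      Integrable (fun x => (v x : ℝ)) (rieszMeasure (positiveFunctional L)) := fun v L =>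
    have := isFiniteMeasure_rieszMeasure_positiveFunctional L
    (show Continuous fun x => (v x : ℝ) by fun_prop).integrable_of_hasCompactSupport
      (v.hasCompactSupport.comp_left (g := fun r : ℝ≥0 => (r : ℝ)) rfl)
  simp_rw [hp]
  rw [integral_sub (hi _ _) (hi _ _), integral_sub (hi _ _) (hi _ _)]
  conv_lhs => rw [hpq, map_sub, key, key]
  ring

end Representation

end FracBV

end SignedRiesz

/-! ### The kernel, the Besov integral and the Hölder estimates -/

noncomputable section Kernel

open Filter Topology

namespace FracBV

variable {n : ℕ} {α : ℝ} {E E' : Type*} [NormedAddCommGroup E] [NormedAddCommGroup E']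

/-- The vector kernel `h / |h|^{n+α+1}`. -/
def rieszKernel (n : ℕ) (α : ℝ) (h : Rn n) : Rn n := (‖h‖ ^ ((n : ℝ) + α + 1))⁻¹ • h

/-- The scalar weight `|h|^{-n-α}`. -/
def rieszWeight (n : ℕ) (α : ℝ) (h : Rn n) : ℝ := ‖h‖ ^ (-((n : ℝ) + α))

theorem rieszWeight_nonneg (h : Rn n) : 0 ≤ rieszWeight n α h := by
  unfold rieszWeight; positivity

theorem norm_rieszKernel (hα : 0 < α) (h : Rn n) : ‖rieszKernel n α h‖ = rieszWeight n α h := by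
  have hn : (0 : ℝ) < (n : ℝ) + α := by positivity
  rcases eq_or_ne h 0 with rfl | hh
  -- At h = 0 both sides are 0, because a real power of 0 with nonzero exponent is 0.
  · simp only [rieszKernel, rieszWeight, norm_zero, smul_zero, Real.zero_rpow (neg_ne_zero.2 hn.ne')]
  · have h0 : 0 < ‖h‖ := norm_pos_iff.2 hh
    rw [rieszKernel, rieszWeight, norm_smul, norm_inv, Real.norm_of_nonneg (by positivity),
      Real.rpow_neg h0.le, Real.rpow_add h0 _ 1, Real.rpow_one]
    field_simp

theorem rieszKernel_neg (h : Rn n) : rieszKernel n α (-h) = -rieszKernel n α h := by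
  simp [rieszKernel]

theorem measurable_rieszKernel : Measurable (rieszKernel n α) := by
  unfold rieszKernel; fun_prop

theorem measurable_rieszWeight : Measurable (rieszWeight n α) := by
  unfold rieszWeight; fun_prop

/-- In polar coordinates the integrand is r^{-α} on (0, 1), integrable as α < 1, and r^{-1-α} on (1,
∞), integrable as α > 0. -/
theorem integrable_min_mul_rieszWeight (hn : 1 ≤ n) (hα0 : 0 < α) (hα1 : α < 1) :
    Integrable (fun h : Rn n => min ‖h‖ 1 * rieszWeight n α h) := by
  have : Nonempty (Fin n) := ⟨⟨0, hn⟩⟩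
  have hn' : (1 : ℝ) ≤ n := by exact_mod_cast hn
  unfold rieszWeight
  rw [integrable_fun_norm_addHaar volume (f := fun r : ℝ => min r 1 * r ^ (-((n : ℝ) + α)))]
  have hdim : Module.finrank ℝ (Rn n) = n := by simp
  rw [hdim]
  have hpow : ∀ y : ℝ, 0 < y → y ^ (n - 1) • (min y 1 * y ^ (-((n : ℝ) + α))) =
      min y 1 * y ^ (-1 - α) := by
    intro y hy
    have : (y : ℝ) ^ (n - 1) = y ^ ((n : ℝ) - 1) := by
      rw [← Real.rpow_natCast]; congr 1; push_cast [hn]; rfl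
    rw [smul_eq_mul, this, mul_left_comm, ← Real.rpow_add hy]
    ring_nf
  rw [integrableOn_congr_fun (fun y (hy : y ∈ Set.Ioi 0) => hpow y hy) measurableSet_Ioi,
    ← Set.Ioc_union_Ioi_eq_Ioi (zero_le_one' ℝ)]
  refine IntegrableOn.union ?_ ?_
  · rw [integrableOn_Ioc_iff_integrableOn_Ioo]
    have h1 : IntegrableOn (fun y : ℝ => y ^ (-α)) (Set.Ioo 0 1) :=
      (intervalIntegral.integrableOn_Ioo_rpow_iff zero_lt_one).2 (by linarith)
    refine h1.congr_fun (fun y hy => ?_) measurableSet_Ioo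
    change y ^ (-α) = min y 1 * y ^ (-1 - α)
    rw [min_eq_left hy.2.le]
    nth_rewrite 2 [← Real.rpow_one y]
    rw [← Real.rpow_add hy.1]
    ring_nf
  · have h1 : IntegrableOn (fun y : ℝ => y ^ (-1 - α)) (Set.Ioi 1) :=
      integrableOn_Ioi_rpow_of_lt (by linarith) zero_lt_one
    refine h1.congr_fun (fun y hy => ?_) measurableSet_Ioi
    change y ^ (-1 - α) = min y 1 * y ^ (-1 - α)
    rw [min_eq_right (le_of_lt hy), one_mul]

/-- For q = ∞ continuity turns the essential supremum into a supremum of continuous functions of h,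
which is lower semicontinuous; for finite q this is Tonelli. -/
theorem measurable_eLpNorm_increment {u : Rn n → E} (hu : Continuous u) (q : ℝ≥0∞) :
    Measurable fun h : Rn n => eLpNorm (fun x => u (x + h) - u x) q volume := by
  rcases eq_or_ne q 0 with rfl | hq0
  · simp
  rcases eq_or_ne q ⊤ with rfl | hq
  · have : (fun h : Rn n => eLpNorm (fun x => u (x + h) - u x) ⊤ volume) =
        fun h => ⨆ x, ‖u (x + h) - u x‖ₑ := by
      ext h
      rw [eLpNorm_exponent_top, eLpNormEssSup]
      refine le_antisymm essSup_le_iSup (iSup_le fun x => ?_)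
      by_contra! hx
      have hc : Continuous fun x => ‖u (x + h) - u x‖ₑ := by fun_prop
      have ho : IsOpen {y | essSup (fun x => ‖u (x + h) - u x‖ₑ) volume < ‖u (y + h) - u y‖ₑ} :=
        isOpen_lt continuous_const hc
      have h0 := ho.measure_pos volume ⟨x, hx⟩
      exact h0.ne' (meas_essSup_lt (f := fun x => ‖u (x + h) - u x‖ₑ))
    rw [this]
    refine LowerSemicontinuous.measurable (lowerSemicontinuous_iSup fun x => ?_)
    exact Continuous.lowerSemicontinuous (by fun_prop)
  · simp_rw [eLpNorm_eq_lintegral_rpow_enorm_toReal hq0 hq]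
    refine Measurable.pow_const ?_ _
    have hm : Measurable fun z : Rn n × Rn n => ‖u (z.1 + z.2) - u z.1‖ₑ ^ q.toReal :=
      Measurable.pow_const (Continuous.measurable (by fun_prop)) _
    exact hm.lintegral_prod_left'

/-- The weighted integral `∫ ‖u(· + h) - u‖_q |h|^{-n-α} dh`. -/
def besovIntegral (α : ℝ) (q : ℝ≥0∞) (u : Rn n → E) : ℝ≥0∞ :=
  ∫⁻ h : Rn n, eLpNorm (fun x => u (x + h) - u x) q volume * ENNReal.ofReal (rieszWeight n α h)

theorem measurable_besovIntegrand {u : Rn n → E} (hu : Continuous u) (q : ℝ≥0∞) :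
    Measurable fun h : Rn n =>
      eLpNorm (fun x => u (x + h) - u x) q volume * ENNReal.ofReal (rieszWeight n α h) :=
  (measurable_eLpNorm_increment hu q).mul measurable_rieszWeight.ennreal_ofReal

theorem besovSeminorm_one_eq (hα : 0 < α) (q : ℝ≥0∞) (u : Rn n → ℝ) :
    besovSeminorm α q 1 u = besovIntegral α q u := by
  have hn : (0 : ℝ) < (n : ℝ) + α := by positivity
  simp only [besovSeminorm, besovIntegral, ENNReal.one_ne_top, if_false, ENNReal.toReal_one,
    ENNReal.rpow_one, one_mul, div_one]
  refine lintegral_congr fun h => ?_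
  rcases eq_or_ne h 0 with rfl | hh
  · simp
  · have h0 : 0 < ‖h‖ := norm_pos_iff.2 hh
    rw [rieszWeight, Real.rpow_neg h0.le, ENNReal.ofReal_inv_of_pos (by positivity), div_eq_mul_inv]

theorem lintegral_enorm_mul_le {p q : ℝ≥0∞} [ENNReal.HolderConjugate p q] {F : Rn n → E}
    {v : Rn n → E'} (hF : AEStronglyMeasurable F volume) (hv : AEStronglyMeasurable v volume) :
    ∫⁻ x, ‖F x‖ₑ * ‖v x‖ₑ ≤ eLpNorm F p volume * eLpNorm v q volume := by
  have h := eLpNorm_smul_le_mul_eLpNorm (p := p) (q := q) (r := 1) (f := fun x => ‖v x‖)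
    (μ := (volume : Measure (Rn n))) hv.norm (φ := fun x => ‖F x‖) hF.norm
  rw [eLpNorm_one_eq_lintegral_enorm, eLpNorm_norm, eLpNorm_norm] at h
  simpa [enorm_mul] using h

/-- Tonelli with h outermost, then Hölder in x. F may depend on h so that both F(x) and its
translate F(x + h) are covered, with the same L^p bound. -/
theorem lintegral_increment_le {p q : ℝ≥0∞} [ENNReal.HolderConjugate p q]
    {F : Rn n × Rn n → E} {u : Rn n → E'} {C : ℝ≥0∞}
    (hF : AEStronglyMeasurable F (volume.prod volume)) (hu : Continuous u)
    (hFm : ∀ h, AEStronglyMeasurable (fun x => F (x, h)) volume)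
    (hFC : ∀ h, eLpNorm (fun x => F (x, h)) p volume ≤ C) :
    ∫⁻ z : Rn n × Rn n, ‖F z‖ₑ * ‖u (z.1 + z.2) - u z.1‖ₑ *
      ENNReal.ofReal (rieszWeight n α z.2) ∂(volume.prod volume) ≤ C * besovIntegral α q u := by
  have hw : Measurable fun z : Rn n × Rn n => ENNReal.ofReal (rieszWeight n α z.2) :=
    (measurable_rieszWeight.comp measurable_snd).ennreal_ofReal
  have hd : Continuous fun z : Rn n × Rn n => ‖u (z.1 + z.2) - u z.1‖ₑ := by fun_prop
  have hm : AEMeasurable (fun z : Rn n × Rn n => ‖F z‖ₑ * ‖u (z.1 + z.2) - u z.1‖ₑ *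
      ENNReal.ofReal (rieszWeight n α z.2)) (volume.prod volume) :=
    (hF.enorm.mul hd.measurable.aemeasurable).mul hw.aemeasurable
  rw [lintegral_prod_symm _ hm,
    besovIntegral, ← lintegral_const_mul _ (measurable_besovIntegrand hu q)]
  refine lintegral_mono fun h => ?_
  dsimp only
  rw [lintegral_mul_const' _ _ ENNReal.ofReal_ne_top, ← mul_assoc]
  gcongr
  refine (lintegral_enorm_mul_le (p := p) (q := q) (hFm h)
    (Continuous.aestronglyMeasurable (by fun_prop))).trans ?_
  gcongr
  exact hFC h

theorem integrable_increment {p q : ℝ≥0∞} [ENNReal.HolderConjugate p q]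
    {F : Rn n × Rn n → E} {u : Rn n → E'} {C : ℝ≥0∞}
    (hF : AEStronglyMeasurable F (volume.prod volume)) (hu : Continuous u)
    (hFm : ∀ h, AEStronglyMeasurable (fun x => F (x, h)) volume)
    (hFC : ∀ h, eLpNorm (fun x => F (x, h)) p volume ≤ C) (hC : C < ⊤)
    (hb : besovIntegral α q u < ⊤) :
    Integrable (fun z : Rn n × Rn n => ‖F z‖ * ‖u (z.1 + z.2) - u z.1‖ * rieszWeight n α z.2)
      (volume.prod volume) := by
  have hw : Measurable fun z : Rn n × Rn n => rieszWeight n α z.2 :=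
    measurable_rieszWeight.comp measurable_snd
  have hd : Continuous fun z : Rn n × Rn n => ‖u (z.1 + z.2) - u z.1‖ := by fun_prop
  refine ⟨(hF.norm.mul hd.aestronglyMeasurable).mul hw.aestronglyMeasurable, ?_⟩
  refine lt_of_le_of_lt ?_ (ENNReal.mul_lt_top hC hb)
  refine le_trans (lintegral_mono fun z => ?_)
    (lintegral_increment_le (p := p) (q := q) hF hu hFm hFC)
  rw [enorm_mul, enorm_mul, enorm_norm, enorm_norm, Real.enorm_of_nonneg (rieszWeight_nonneg _)]

theorem integrable_fst_increment {p q : ℝ≥0∞} [ENNReal.HolderConjugate p q]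
    {F : Rn n → E} {u : Rn n → E'} (hF : MemLp F p) (hu : Continuous u)
    (hb : besovIntegral α q u < ⊤) :
    Integrable (fun z : Rn n × Rn n => ‖F z.1‖ * ‖u (z.1 + z.2) - u z.1‖ * rieszWeight n α z.2)
      (volume.prod volume) :=
  integrable_increment (p := p) (q := q) (F := fun z => F z.1) hF.1.comp_fst hu
    (fun _ => hF.1) (fun _ => le_rfl) hF.2 hb

theorem integrable_shift_increment {p q : ℝ≥0∞} [ENNReal.HolderConjugate p q]
    {F : Rn n → E} {u : Rn n → E'} (hF : MemLp F p) (hu : Continuous u)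
    (hb : besovIntegral α q u < ⊤) :
    Integrable (fun z : Rn n × Rn n => ‖F (z.1 + z.2)‖ * ‖u (z.1 + z.2) - u z.1‖ *
      rieszWeight n α z.2) (volume.prod volume) := by
  refine integrable_increment (p := p) (q := q) (F := fun z => F (z.1 + z.2)) ?_ hu
    (fun h => ?_) (fun h => ?_) hF.2 hb
  · exact (hF.1.comp_snd).comp_measurePreserving (measurePreserving_prod_add volume volume)
  · exact hF.1.comp_measurePreserving (measurePreserving_add_right volume h)
  · exact (eLpNorm_comp_measurePreserving hF.1 (measurePreserving_add_right volume h)).le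

end FracBV

end Kernel

/-! ### Increment form of the operators and the pairing of f with a test field -/

noncomputable section TestPairing

open Filter Topology

namespace FracBV

variable {n : ℕ} {α : ℝ} {E : Type*} [NormedAddCommGroup E] [NormedSpace ℝ E]

theorem gradKernel_add (f : Rn n → ℝ) (x h : Rn n) :
    gradKernel α f x (x + h) = (f (x + h) - f x) • rieszKernel n α h := by
  simp [gradKernel, rieszKernel, smul_smul, div_eq_mul_inv]

theorem gradNLKernel_add (f g : Rn n → ℝ) (x h : Rn n) :
    gradNLKernel α f g x (x + h) =
      ((f (x + h) - f x) * (g (x + h) - g x)) • rieszKernel n α h := by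
  simp [gradNLKernel, rieszKernel, smul_smul, div_eq_mul_inv]

theorem fracGrad_eq (f : Rn n → ℝ) (x : Rn n) :
    fracGrad α f x = fracConst n α • ∫ h, (f (x + h) - f x) • rieszKernel n α h := by
  simp_rw [fracGrad, ← gradKernel_add]
  rw [integral_add_left_eq_self (gradKernel α f x) x]

theorem fracGradNL_eq (f g : Rn n → ℝ) (x : Rn n) :
    fracGradNL α f g x = fracConst n α •
      ∫ h, ((f (x + h) - f x) * (g (x + h) - g x)) • rieszKernel n α h := by
  simp_rw [fracGradNL, ← gradNLKernel_add]
  rw [integral_add_left_eq_self (gradNLKernel α f g x) x]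

theorem fracDiv_eq (φ : Rn n → Rn n) (x : Rn n) :
    fracDiv α φ x = fracConst n α * ∫ h, inner ℝ (rieszKernel n α h) (φ (x + h) - φ x) := by
  rw [fracDiv, ← integral_add_left_eq_self _ x]
  congr 2; ext h
  rw [rieszKernel, inner_smul_left, add_sub_cancel_left, div_eq_inv_mul]
  simp

/-- Increments of a test field are at most a constant times min(|h|, 1) and are supported in the
support and its translate, so their L^q norm is O(min(|h|, 1)). -/
theorem besovIntegral_lt_top_of_test (hn : 1 ≤ n) (hα0 : 0 < α) (hα1 : α < 1) {q : ℝ≥0∞}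
    (hq : 1 ≤ q) {φ : Rn n → E} (hφ : ContDiff ℝ ∞ φ) (hc : HasCompactSupport φ) :
    besovIntegral α q φ < ⊤ := by
  obtain ⟨L, hL⟩ := ContDiff.lipschitzWith_of_hasCompactSupport hc hφ (by simp)
  obtain ⟨M, hM⟩ := hφ.continuous.bounded_above_of_compact_support hc
  -- The Lipschitz constant serves |h| ≤ 1, twice the sup bound serves |h| ≥ 1.
  set A : ℝ := max L (2 * M) with hA
  have hA0 : 0 ≤ A := L.2.trans (le_max_left _ _)
  set K := tsupport φ
  have hK : MeasurableSet K := (isClosed_tsupport φ).measurableSet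
  set d : Rn n → ℝ := K.indicator fun _ => 1 with hd
  have hd0 : ∀ x, 0 ≤ d x := fun x => Set.indicator_nonneg (fun _ _ => zero_le_one) x
  have hdL : MemLp d q := memLp_indicator_const q hK 1 (Or.inr hc.isCompact.measure_lt_top.ne)
  have hpt : ∀ h x, ‖φ (x + h) - φ x‖ ≤ A * min ‖h‖ 1 * (d (x + h) + d x) := by
    intro h x
    by_cases hx : x ∉ K ∧ x + h ∉ K
    · rw [image_eq_zero_of_notMem_tsupport hx.1, image_eq_zero_of_notMem_tsupport hx.2, sub_zero,
        norm_zero]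
      exact mul_nonneg (by positivity) (add_nonneg (hd0 _) (hd0 _))
    · have h1 : 1 ≤ d (x + h) + d x := by
        by_cases hxK : x ∈ K
        · have : d x = 1 := by simp [hd, hxK]
          linarith [hd0 (x + h)]
        · have hxh : x + h ∈ K := by tauto
          have : d (x + h) = 1 := by simp [hd, hxh]
          linarith [hd0 x]
      have h2 : ‖φ (x + h) - φ x‖ ≤ A * min ‖h‖ 1 := by
        rcases le_total ‖h‖ 1 with hh | hh
        · rw [min_eq_left hh]
          have := hL.norm_sub_le (x + h) x
          rw [add_sub_cancel_left] at this
          exact this.trans (by gcongr; exact le_max_left _ _)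
        · rw [min_eq_right hh, mul_one]
          calc ‖φ (x + h) - φ x‖ ≤ ‖φ (x + h)‖ + ‖φ x‖ := norm_sub_le _ _
            _ ≤ 2 * M := by linarith [hM (x + h), hM x]
            _ ≤ A := le_max_right _ _
      exact h2.trans (le_mul_of_one_le_right (by positivity) h1)
  have hnorm : ∀ h, eLpNorm (fun x => φ (x + h) - φ x) q volume ≤
      ENNReal.ofReal (A * min ‖h‖ 1) * (2 * eLpNorm d q volume) := by
    intro h
    have hsh := measurePreserving_add_right (volume : Measure (Rn n)) h
    calc eLpNorm (fun x => φ (x + h) - φ x) q volume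
        ≤ eLpNorm ((A * min ‖h‖ 1) • ((fun x => d (x + h)) + d)) q volume :=
          eLpNorm_mono_real fun x => by simpa using hpt h x
      _ = ENNReal.ofReal (A * min ‖h‖ 1) * eLpNorm ((fun x => d (x + h)) + d) q volume := by
          rw [eLpNorm_const_smul, Real.enorm_of_nonneg (by positivity)]
      _ ≤ _ := by
          gcongr
          refine (eLpNorm_add_le (hdL.1.comp_measurePreserving hsh) hdL.1 hq).trans ?_
          rw [two_mul]
          gcongr
          exact (eLpNorm_comp_measurePreserving hdL.1 hsh).le
  have hfin := (integrable_min_mul_rieszWeight hn hα0 hα1).const_mul A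
  calc besovIntegral α q φ
      ≤ ∫⁻ h, (2 * eLpNorm d q volume) * ENNReal.ofReal (A * (min ‖h‖ 1 * rieszWeight n α h)) := by
        refine lintegral_mono fun h => ?_
        dsimp only
        rw [← mul_assoc A, ENNReal.ofReal_mul (by positivity), ← mul_assoc,
          mul_comm (2 * _)]
        gcongr
        exact hnorm h
    _ = (2 * eLpNorm d q volume) * ∫⁻ h, ENNReal.ofReal (A * (min ‖h‖ 1 * rieszWeight n α h)) :=
        lintegral_const_mul' _ _ (ENNReal.mul_ne_top (by simp) hdL.2.ne)
    _ < ⊤ := by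
        refine ENNReal.mul_lt_top (ENNReal.mul_lt_top (by simp) hdL.2) ?_
        exact hfin.lintegral_lt_top

/-- The double integral `∬ f(x) (h · (φ(x+h) - φ(x))) |h|^{-n-α-1} dh dx`. -/
def divPairing (α : ℝ) (f : Rn n → ℝ) (φ : Rn n → Rn n) : ℝ :=
  ∫ z : Rn n × Rn n, f z.1 * inner ℝ (rieszKernel n α z.2) (φ (z.1 + z.2) - φ z.1)
    ∂(volume.prod volume)

theorem aestronglyMeasurable_inner_increment {φ : Rn n → Rn n} (hφ : Continuous φ)
    (μ : Measure (Rn n × Rn n)) :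
    AEStronglyMeasurable (fun z : Rn n × Rn n =>
      (inner ℝ (rieszKernel n α z.2) (φ (z.1 + z.2) - φ z.1) : ℝ)) μ := by
  have h1 : Measurable fun z : Rn n × Rn n => rieszKernel n α z.2 :=
    measurable_rieszKernel.comp measurable_snd
  have h2 : Continuous fun z : Rn n × Rn n => φ (z.1 + z.2) - φ z.1 := by fun_prop
  exact h1.aestronglyMeasurable.inner h2.aestronglyMeasurable

theorem abs_inner_rieszKernel_le (hα0 : 0 < α) (h v : Rn n) :
    ‖(inner ℝ (rieszKernel n α h) v : ℝ)‖ ≤ ‖v‖ * rieszWeight n α h := by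
  refine (norm_inner_le_norm _ _).trans ?_
  rw [norm_rieszKernel hα0, mul_comm]

variable {p q : ℝ≥0∞} [ENNReal.HolderConjugate p q]

theorem integrable_divPairing (hα0 : 0 < α) {f : Rn n → ℝ} (hf : MemLp f p) {φ : Rn n → Rn n}
    (hφ : Continuous φ) (hb : besovIntegral α q φ < ⊤) :
    Integrable (fun z : Rn n × Rn n =>
      f z.1 * inner ℝ (rieszKernel n α z.2) (φ (z.1 + z.2) - φ z.1)) (volume.prod volume) := by
  refine (integrable_fst_increment hf hφ hb).mono'
    (hf.1.comp_fst.mul (aestronglyMeasurable_inner_increment hφ _))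
    (Eventually.of_forall fun z => ?_)
  rw [norm_mul, mul_assoc]
  gcongr
  exact abs_inner_rieszKernel_le hα0 _ _

theorem integral_mul_fracDiv (hα0 : 0 < α) {f : Rn n → ℝ} (hf : MemLp f p) {φ : Rn n → Rn n}
    (hφ : Continuous φ) (hb : besovIntegral α q φ < ⊤) :
    ∫ x, f x * fracDiv α φ x = fracConst n α * divPairing α f φ := by
  rw [divPairing, integral_prod _ (integrable_divPairing hα0 hf hφ hb), ← integral_const_mul]
  congr 1; ext x
  rw [fracDiv_eq]
  dsimp only
  rw [integral_const_mul]
  ring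

theorem divPairing_add (hα0 : 0 < α) {f : Rn n → ℝ} (hf : MemLp f p) {φ ψ : Rn n → Rn n}
    (hφ : Continuous φ) (hbφ : besovIntegral α q φ < ⊤)
    (hψ : Continuous ψ) (hbψ : besovIntegral α q ψ < ⊤) :
    divPairing α f (fun x => φ x + ψ x) = divPairing α f φ + divPairing α f ψ := by
  rw [divPairing, divPairing, divPairing, ← integral_add (integrable_divPairing hα0 hf hφ hbφ)
    (integrable_divPairing hα0 hf hψ hbψ)]
  congr 1; ext z
  rw [← mul_add, ← inner_add_right]
  congr 2; abel

theorem divPairing_smul (c : ℝ) (f : Rn n → ℝ) (φ : Rn n → Rn n) :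
    divPairing α f (fun x => c • φ x) = c * divPairing α f φ := by
  rw [divPairing, divPairing, ← integral_const_mul]
  congr 1; ext z
  rw [← smul_sub, inner_smul_right]
  ring

end FracBV

end TestPairing

/-! ### Mollification and Besov test fields -/

noncomputable section Mollification

open Filter Topology

namespace FracBV

variable {n : ℕ} {α : ℝ} {F : Type*} [NormedAddCommGroup F] [NormedSpace ℝ F]
  {ψ : Rn n → F} (ρ : ContDiffBump (0 : Rn n))

/-- The mollification of `ψ` by a normalized bump function. -/
def mollify (ψ : Rn n → F) : Rn n → F :=
  convolution (ρ.normed volume) ψ (ContinuousLinearMap.lsmul ℝ ℝ) volume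

theorem mollify_apply (x : Rn n) : mollify ρ ψ x = ∫ t, ρ.normed volume t • ψ (x - t) := rfl

theorem contDiff_mollify (hψ : Continuous ψ) : ContDiff ℝ ∞ (mollify ρ ψ) :=
  HasCompactSupport.contDiff_convolution_left _ ρ.hasCompactSupport_normed ρ.contDiff_normed
    hψ.locallyIntegrable

theorem hasCompactSupport_mollify (hc : HasCompactSupport ψ) :
    HasCompactSupport (mollify ρ ψ) :=
  HasCompactSupport.convolution _ ρ.hasCompactSupport_normed hc

theorem integrable_mollify (hψ : Continuous ψ) (x : Rn n) :
    Integrable fun t => ρ.normed volume t • ψ (x - t) :=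
  (ρ.continuous_normed.smul (by fun_prop)).integrable_of_hasCompactSupport
    ρ.hasCompactSupport_normed.smul_right

theorem norm_mollify_le {M : ℝ} (hM : ∀ x, ‖ψ x‖ ≤ M) (x : Rn n) : ‖mollify ρ ψ x‖ ≤ M := by
  have h : ‖mollify ρ ψ x‖ ≤ ∫ t, ρ.normed volume t * M := by
    refine norm_integral_le_of_norm_le (ρ.integrable_normed.mul_const M)
      (Eventually.of_forall fun t => ?_)
    rw [ContinuousLinearMap.lsmul_apply, norm_smul, Real.norm_of_nonneg (ρ.nonneg_normed t)]
    exact mul_le_mul_of_nonneg_left (hM _) (ρ.nonneg_normed t)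
  rwa [integral_mul_const, ρ.integral_normed, one_mul] at h

theorem mollify_eq_zero {R : ℝ} (hR : ∀ x, R < ‖x‖ → ψ x = 0) {x : Rn n}
    (hx : R + ρ.rOut < ‖x‖) : mollify ρ ψ x = 0 := by
  rw [mollify_apply, integral_eq_zero_of_ae]
  refine Eventually.of_forall fun t => ?_
  by_cases ht : t ∈ Metric.ball (0 : Rn n) ρ.rOut
  · have h1 : ‖t‖ < ρ.rOut := by simpa using ht
    have h2 : ‖x‖ - ‖t‖ ≤ ‖x - t‖ := norm_sub_norm_le x t
    simp [hR (x - t) (by linarith)]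
  · rw [← ρ.support_normed_eq (μ := volume), Function.notMem_support] at ht
    simp [ht]

/-- Young's inequality in dual form: mollification commutes with translation, Hölder is applied for
each shift t, and the bump has integral 1. The bound does not depend on ρ, as dominated convergence
requires. -/
theorem lintegral_mollify_increment_le {p q : ℝ≥0∞} [ENNReal.HolderConjugate p q] {f : Rn n → ℝ}
    (hf : AEStronglyMeasurable f volume) (hψ : Continuous ψ) (h : Rn n) :
    ∫⁻ x, ‖f x‖ₑ * ‖mollify ρ ψ (x + h) - mollify ρ ψ x‖ₑ ≤
      eLpNorm f p volume * eLpNorm (fun x => ψ (x + h) - ψ x) q volume := by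
  set N := eLpNorm f p volume * eLpNorm (fun x => ψ (x + h) - ψ x) q volume
  have hinc : ∀ x, ‖mollify ρ ψ (x + h) - mollify ρ ψ x‖ₑ ≤
      ∫⁻ t, ‖ρ.normed volume t‖ₑ * ‖ψ (x + h - t) - ψ (x - t)‖ₑ := by
    intro x
    rw [mollify_apply, mollify_apply, ← integral_sub (integrable_mollify ρ hψ _)
      (integrable_mollify ρ hψ _)]
    refine (enorm_integral_le_lintegral_enorm _).trans (le_of_eq ?_)
    congr 1; ext t
    rw [← smul_sub, enorm_smul]
  have hρm : Measurable fun t => ‖ρ.normed volume t‖ₑ := ρ.continuous_normed.enorm.measurable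
  have hm2 : Measurable fun z : Rn n × Rn n => ‖ψ (z.1 + h - z.2) - ψ (z.1 - z.2)‖ₑ :=
    Continuous.measurable (by fun_prop)
  calc ∫⁻ x, ‖f x‖ₑ * ‖mollify ρ ψ (x + h) - mollify ρ ψ x‖ₑ
      ≤ ∫⁻ x, ∫⁻ t, ‖f x‖ₑ * (‖ρ.normed volume t‖ₑ * ‖ψ (x + h - t) - ψ (x - t)‖ₑ) := by
        refine lintegral_mono fun x => ?_
        rw [lintegral_const_mul' _ _ enorm_ne_top]
        gcongr
        exact hinc x
    _ = ∫⁻ t, ∫⁻ x, ‖f x‖ₑ * (‖ρ.normed volume t‖ₑ * ‖ψ (x + h - t) - ψ (x - t)‖ₑ) := by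
        refine lintegral_lintegral_swap ?_
        exact hf.enorm.comp_fst.mul
          ((hρm.comp measurable_snd).mul hm2).aemeasurable
    _ ≤ ∫⁻ t, ‖ρ.normed volume t‖ₑ * N := by
        refine lintegral_mono fun t => ?_
        dsimp only
        simp_rw [mul_left_comm ‖f _‖ₑ]
        rw [lintegral_const_mul' _ _ enorm_ne_top]
        gcongr
        have hsh := measurePreserving_sub_right (volume : Measure (Rn n)) t
        refine (lintegral_enorm_mul_le (p := p) (q := q) (v := fun x => ψ (x + h - t) - ψ (x - t))
          hf (Continuous.aestronglyMeasurable (by fun_prop))).trans ?_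
        refine mul_le_mul_right (le_of_eq ?_) _
        rw [← eLpNorm_comp_measurePreserving (g := fun x => ψ (x + h) - ψ x)
          (Continuous.aestronglyMeasurable (by fun_prop)) hsh]
        congr 1; ext x
        simp only [Function.comp]
        congr 2; abel
    _ = (∫⁻ t, ‖ρ.normed volume t‖ₑ) * N := lintegral_mul_const _ hρm
    _ = N := by
        have : ∫⁻ t, ‖ρ.normed volume t‖ₑ = 1 := by
          simp_rw [Real.enorm_of_nonneg (ρ.nonneg_normed _)]
          rw [← ofReal_integral_eq_lintegral_ofReal ρ.integrable_normed
            (Eventually.of_forall ρ.nonneg_normed), ρ.integral_normed, ENNReal.ofReal_one]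
        rw [this, one_mul]

/-- Dominated convergence twice: in x for fixed h, then in h. This needs only pointwise convergence
of the mollifications, not convergence in the Besov norm. -/
theorem tendsto_divPairing_mollify {p q : ℝ≥0∞} [ENNReal.HolderConjugate p q] (hp : 1 ≤ p)
    (hn : 1 ≤ n) (hα0 : 0 < α) (hα1 : α < 1) (hq : 1 ≤ q)
    {f : Rn n → ℝ} (hf : MemLp f p) {ψ : Rn n → Rn n} (hψ : Continuous ψ)
    (hc : HasCompactSupport ψ) (hb : besovIntegral α q ψ < ⊤) {ρ : ℕ → ContDiffBump (0 : Rn n)}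
    (hρ : Tendsto (fun k => (ρ k).rOut) atTop (𝓝 0)) (hρ1 : ∀ k, (ρ k).rOut ≤ 1) :
    Tendsto (fun k => divPairing α f (mollify (ρ k) ψ)) atTop (𝓝 (divPairing α f ψ)) := by
  have hlim : ∀ x, Tendsto (fun k => mollify (ρ k) ψ x) atTop (𝓝 (ψ x)) := fun x =>
    ContDiffBump.convolution_tendsto_right_of_continuous hρ hψ x
  have hcont : ∀ k, Continuous (mollify (ρ k) ψ) := fun k => (contDiff_mollify _ hψ).continuous
  have hbk : ∀ k, besovIntegral α q (mollify (ρ k) ψ) < ⊤ := fun k =>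
    besovIntegral_lt_top_of_test hn hα0 hα1 hq (contDiff_mollify _ hψ)
      (hasCompactSupport_mollify _ hc)
  obtain ⟨M, hM⟩ := hψ.bounded_above_of_compact_support hc
  obtain ⟨R, hR⟩ : ∃ R : ℝ, ∀ x, R < ‖x‖ → ψ x = 0 := by
    obtain ⟨R, hR⟩ := hc.isCompact.isBounded.subset_closedBall (0 : Rn n)
    refine ⟨R, fun x hx => image_eq_zero_of_notMem_tsupport fun hxs => ?_⟩
    have := hR hxs
    simp at this
    linarith
  have hint : ∀ k, Integrable (fun z : Rn n × Rn n => f z.1 * inner ℝ (rieszKernel n α z.2)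
      (mollify (ρ k) ψ (z.1 + z.2) - mollify (ρ k) ψ z.1)) (volume.prod volume) := fun k =>
    integrable_divPairing hα0 hf (hcont k) (hbk k)
  unfold divPairing
  simp_rw [integral_prod_symm _ (hint _), integral_prod_symm _ (integrable_divPairing hα0 hf hψ hb)]
  -- The majorant for the outer integral: its finiteness is exactly the Besov hypothesis on ψ.
  set B : Rn n → ℝ≥0∞ := fun h => eLpNorm f p volume *
    (eLpNorm (fun x => ψ (x + h) - ψ x) q volume * ENNReal.ofReal (rieszWeight n α h)) with hB
  have hBm : Measurable B := (measurable_besovIntegrand hψ q).const_mul _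
  have hBfin : ∫⁻ h, B h ≠ ⊤ := by
    rw [lintegral_const_mul _ (measurable_besovIntegrand hψ q)]
    exact (ENNReal.mul_lt_top hf.2 hb).ne
  refine tendsto_integral_of_dominated_convergence (fun h => (B h).toReal)
    (fun k => (hint k).swap.integral_prod_left.1)
    (integrable_toReal_of_lintegral_ne_top hBm.aemeasurable hBfin) (fun k => ?_) ?_
  · filter_upwards [ae_lt_top hBm hBfin] with h hh
    rw [← toReal_enorm]
    refine ENNReal.toReal_mono hh.ne ((enorm_integral_le_lintegral_enorm _).trans ?_)
    calc ∫⁻ x, ‖f x * inner ℝ (rieszKernel n α h)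
          (mollify (ρ k) ψ (x + h) - mollify (ρ k) ψ x)‖ₑ
        ≤ ∫⁻ x, (‖f x‖ₑ * ‖mollify (ρ k) ψ (x + h) - mollify (ρ k) ψ x‖ₑ) *
            ENNReal.ofReal (rieszWeight n α h) := by
          refine lintegral_mono fun x => ?_
          dsimp only
          rw [enorm_mul, mul_assoc]
          gcongr
          rw [← ofReal_norm, ← ofReal_norm, ← ENNReal.ofReal_mul (norm_nonneg _)]
          exact ENNReal.ofReal_le_ofReal (abs_inner_rieszKernel_le hα0 _ _)
      _ ≤ B h := by
          rw [lintegral_mul_const' _ _ ENNReal.ofReal_ne_top]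
          simp only [hB]
          rw [← mul_assoc]
          gcongr
          exact lintegral_mollify_increment_le (ρ k) hf.1 hψ h
  · refine Eventually.of_forall fun h => ?_
    -- As all mollifier radii are at most 1, the mollified ψ vanishes at x and at x + h when x is
    -- outside S; on S the function f is integrable.
    set S : Set (Rn n) := Metric.closedBall 0 (R + 1 + ‖h‖)
    refine tendsto_integral_of_dominated_convergence
      (fun x => S.indicator (fun x => ‖f x‖ * (2 * M * rieszWeight n α h)) x) (fun k => ?_) ?_
      (fun k => ?_) ?_
    · refine hf.1.mul (Continuous.aestronglyMeasurable ?_)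
      have := hcont k
      fun_prop
    · rw [integrable_indicator_iff Metric.isClosed_closedBall.measurableSet]
      exact (((hf.locallyIntegrable hp).integrableOn_isCompact
        (isCompact_closedBall _ _)).norm).mul_const _
    · refine Eventually.of_forall fun x => ?_
      by_cases hx : x ∈ S
      · rw [Set.indicator_of_mem hx, norm_mul]
        gcongr
        refine (abs_inner_rieszKernel_le hα0 _ _).trans ?_
        gcongr
        · exact rieszWeight_nonneg _
        · refine (norm_sub_le _ _).trans ?_
          linarith [norm_mollify_le (ρ k) hM (x + h), norm_mollify_le (ρ k) hM x]
      · have hx' : R + 1 + ‖h‖ < ‖x‖ := by simpa [S] using hx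
        have h1 : ‖x‖ - ‖h‖ ≤ ‖x + h‖ := by simpa using norm_sub_norm_le x (-h)
        have h2 := hρ1 k
        have h3 := norm_nonneg h
        rw [mollify_eq_zero (ρ k) hR (x := x) (by linarith),
          mollify_eq_zero (ρ k) hR (x := x + h) (by linarith)]
        simp [hx]
    · refine Eventually.of_forall fun x => ?_
      exact tendsto_const_nhds.mul (tendsto_const_nhds.inner ((hlim _).sub (hlim _)))

/-- The integration by parts formula extends from smooth to Besov test fields. -/
theorem divPairing_eq_integral_of_continuous {p q : ℝ≥0∞} [ENNReal.HolderConjugate p q]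
    (hp : 1 ≤ p) (hn : 1 ≤ n) (hα0 : 0 < α) (hα1 : α < 1) (hq : 1 ≤ q)
    {f : Rn n → ℝ} (hf : MemLp f p) {ν : VectorMeasure (Rn n) (Rn n)}
    (hν : IsFracVarMeasure α f ν) {ψ : Rn n → Rn n} (hψ : Continuous ψ)
    (hc : HasCompactSupport ψ) (hb : besovIntegral α q ψ < ⊤) :
    fracConst n α * divPairing α f ψ = -ν.integral ψ (innerSL ℝ) := by
  have hfin := hν.1
  let ρ : ℕ → ContDiffBump (0 : Rn n) := fun k =>
    ⟨1 / (2 * ((k : ℝ) + 1)), 1 / ((k : ℝ) + 1), by positivity, by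
      apply one_div_lt_one_div_of_lt <;> nlinarith [(k.cast_nonneg : (0 : ℝ) ≤ k)]⟩
  have hρ : Tendsto (fun k => (ρ k).rOut) atTop (𝓝 0) := tendsto_one_div_add_atTop_nhds_zero_nat
  have hρ1 : ∀ k, (ρ k).rOut ≤ 1 := fun k => by
    change 1 / ((k : ℝ) + 1) ≤ 1
    rw [div_le_one (by positivity)]
    linarith [(k.cast_nonneg : (0 : ℝ) ≤ k)]
  obtain ⟨M, hM⟩ := hψ.bounded_above_of_compact_support hc
  have h1 := (tendsto_divPairing_mollify hp hn hα0 hα1 hq hf hψ hc hb hρ hρ1).const_mul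
    (fracConst n α)
  have h2 : Tendsto (fun k => ν.integral (mollify (ρ k) ψ) (innerSL ℝ)) atTop
      (𝓝 (ν.integral ψ (innerSL ℝ))) := by
    refine VectorMeasure.tendsto_integral_filter_of_norm_le_const (Eventually.of_forall fun k =>
      (contDiff_mollify _ hψ).continuous.aestronglyMeasurable) ⟨M, Eventually.of_forall fun k =>
      Eventually.of_forall fun x => norm_mollify_le _ hM x⟩ (Eventually.of_forall fun x => ?_)
    exact ContDiffBump.convolution_tendsto_right_of_continuous hρ hψ x
  refine tendsto_nhds_unique h1 (h2.neg.congr fun k => ?_)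
  have hs := contDiff_mollify (ρ k) hψ
  have hcs := hasCompactSupport_mollify (ρ k) hc
  rw [← hν.2 _ hs hcs, integral_mul_fracDiv (q := q) hα0 hf hs.continuous
    (besovIntegral_lt_top_of_test hn hα0 hα1 hq hs hcs)]

end FracBV

end Mollification

/-! ### Existence, uniqueness and total mass of the fractional variation measure -/

noncomputable section VariationMeasure

open Filter Topology
open scoped BoundedContinuousFunction

namespace FracBV

variable {n : ℕ} {α : ℝ}

/-- The subspace of `C_b(ℝⁿ)` of smooth compactly supported functions. -/
def testSubspace (n : ℕ) : Subspace ℝ (Rn n →ᵇ ℝ) where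
  carrier := {u | ContDiff ℝ ∞ u ∧ HasCompactSupport u}
  add_mem' := fun hu hv => ⟨hu.1.add hv.1, hu.2.add hv.2⟩
  zero_mem' := ⟨contDiff_const, HasCompactSupport.zero⟩
  smul_mem' := fun c _ hu => ⟨contDiff_const.smul hu.1, hu.2.smul_left (f := fun _ => c)⟩

/-- Riesz representation on smooth compactly supported functions. -/
theorem exists_measure_sub_eq_test_functional (T : (Rn n → ℝ) → ℝ) (C : ℝ)
    (hadd : ∀ u v, ContDiff ℝ ∞ u → HasCompactSupport u → ContDiff ℝ ∞ v → HasCompactSupport v →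
      T (fun x => u x + v x) = T u + T v)
    (hsmul : ∀ (c : ℝ) u, T (fun x => c * u x) = c * T u)
    (hC : ∀ u (M : ℝ), ContDiff ℝ ∞ u → HasCompactSupport u → 0 ≤ M → (∀ x, |u x| ≤ M) →
      |T u| ≤ C * M) :
    ∃ μ₁ μ₂ : Measure (Rn n), IsFiniteMeasure μ₁ ∧ IsFiniteMeasure μ₂ ∧
      ∀ u, ContDiff ℝ ∞ u → HasCompactSupport u → T u = ∫ x, u x ∂μ₁ - ∫ x, u x ∂μ₂ := by
  let T₀ : testSubspace n →ₗ[ℝ] ℝ :=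
    { toFun := fun u => T u.1
      map_add' := fun u v => hadd u.1 v.1 u.2.1 u.2.2 v.2.1 v.2.2
      map_smul' := fun c u => hsmul c u.1 }
  let T₁ : StrongDual ℝ (testSubspace n) := LinearMap.mkContinuous T₀ C
    fun u : testSubspace n => hC u.1 ‖u‖ u.2.1 u.2.2 (norm_nonneg u)
      fun x => u.1.norm_coe_le_norm x
  -- Hahn–Banach extension to all of C_b, where the signed Riesz theorem applies.
  obtain ⟨L, hL, -⟩ := exists_extension_norm_eq (testSubspace n) T₁
  obtain ⟨μ₁, μ₂, h₁, h₂, h⟩ := exists_measure_sub_eq_functional L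
  refine ⟨μ₁, μ₂, h₁, h₂, fun u hu hc => ?_⟩
  obtain ⟨M, hM⟩ := hu.continuous.bounded_above_of_compact_support hc
  let v : Rn n →ᵇ ℝ := BoundedContinuousFunction.ofNormedAddCommGroup u hu.continuous M hM
  have hv : v ∈ testSubspace n := ⟨hu, hc⟩
  have h3 := hL ⟨v, hv⟩
  exact h3.symm.trans (h v hc)

theorem integral_le_of_fracVariation (f : Rn n → ℝ) (hV : fracVariation α f < ⊤)
    {φ : Rn n → Rn n} (hφ : ContDiff ℝ ∞ φ) (hc : HasCompactSupport φ) (h1 : ∀ x, ‖φ x‖ ≤ 1) :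
    ∫ x, f x * fracDiv α φ x ≤ (fracVariation α f).toReal := by
  rw [← ENNReal.ofReal_le_iff_le_toReal hV.ne]
  exact le_iSup₂_of_le φ hφ (le_iSup₂_of_le hc h1 le_rfl)

/-- For each coordinate i, u ↦ ∫ f div^α(u e_i) is bounded by the variation times the sup norm,
hence is a difference of finite measures; these are the components of ν up to sign. -/
theorem exists_isFracVarMeasure (hn : 1 ≤ n) (hα0 : 0 < α) (hα1 : α < 1) {p q : ℝ≥0∞}
    [ENNReal.HolderConjugate p q] (hq : 1 ≤ q) {f : Rn n → ℝ} (hf : MemBV α p f) :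
    ∃ ν, IsFracVarMeasure α f ν := by
  have hbes : ∀ {φ : Rn n → Rn n}, ContDiff ℝ ∞ φ → HasCompactSupport φ →
      besovIntegral α q φ < ⊤ := fun hφ hc => besovIntegral_lt_top_of_test hn hα0 hα1 hq hφ hc
  have hT : ∀ {φ : Rn n → Rn n}, ContDiff ℝ ∞ φ → HasCompactSupport φ →
      ∫ x, f x * fracDiv α φ x = fracConst n α * divPairing α f φ := fun hφ hc =>
    integral_mul_fracDiv (q := q) hα0 hf.1 hφ.continuous (hbes hφ hc)
  let e : Fin n → Rn n := fun i => EuclideanSpace.single i 1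
  have he : ∀ i, ‖e i‖ = 1 := fun i => by simp [e]
  set V := (fracVariation α f).toReal
  have hV0 : 0 ≤ V := ENNReal.toReal_nonneg
  have hsm : ∀ (i) {u : Rn n → ℝ}, ContDiff ℝ ∞ u → ContDiff ℝ ∞ fun x => u x • e i :=
    fun i _ hu => hu.smul contDiff_const
  have hcs : ∀ (i) {u : Rn n → ℝ}, HasCompactSupport u → HasCompactSupport fun x => u x • e i :=
    fun i _ hc => hc.smul_right
  have hrep := fun i => exists_measure_sub_eq_test_functional
    (fun u => fracConst n α * divPairing α f fun x => u x • e i) V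
    (by
      intro u v hu hcu hv hcv
      simp_rw [add_smul]
      rw [divPairing_add hα0 hf.1 (hsm i hu).continuous (hbes (hsm i hu) (hcs i hcu))
        (hsm i hv).continuous (hbes (hsm i hv) (hcs i hcv)), mul_add])
    (by
      intro c u
      simp_rw [mul_smul]
      rw [divPairing_smul]
      ring)
    (by
      intro u M hu hcu hM0 hM
      -- The variation bounds the pairing only from above; testing with the opposite field bounds
      -- its absolute value.
      have key : ∀ w : Rn n → ℝ, ContDiff ℝ ∞ w → HasCompactSupport w → (∀ x, |w x| ≤ 1) →
          |fracConst n α * divPairing α f fun x => w x • e i| ≤ V := by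
        intro w hw hcw hw1
        have hle : ∀ x, ‖w x • e i‖ ≤ 1 := fun x => by
          rw [norm_smul, he, mul_one]; exact hw1 x
        have h1 := integral_le_of_fracVariation f hf.2 (hsm i hw) (hcs i hcw) hle
        have h2 := integral_le_of_fracVariation f hf.2 (φ := fun x => (-1 : ℝ) • (w x • e i))
          ((hsm i hw).const_smul (-1 : ℝ)) ((hcs i hcw).smul_left (f := fun _ => (-1 : ℝ)))
          (fun x => by rw [norm_smul]; simpa using hle x)
        rw [hT (hsm i hw) (hcs i hcw)] at h1
        rw [hT (φ := fun x => (-1 : ℝ) • (w x • e i)) ((hsm i hw).const_smul (-1 : ℝ))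
          ((hcs i hcw).smul_left (f := fun _ => (-1 : ℝ))), divPairing_smul] at h2
        rw [abs_le]
        constructor <;> linarith
      rcases hM0.eq_or_lt with rfl | hMpos
      · have hu0 : u = fun _ => 0 * (0 : ℝ) := by
          ext x; simpa using hM x
        have h0 : (divPairing α f fun x => u x • e i) = 0 := by
          simp [hu0, divPairing]
        simp [h0]
      · have h1 := key (fun x => M⁻¹ * u x) (contDiff_const.mul hu)
          (hcu.mul_left (f := fun _ => M⁻¹)) fun x => by
            rw [abs_mul, abs_of_pos (inv_pos.2 hMpos), inv_mul_le_iff₀ hMpos, mul_one]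
            exact hM x
        simp_rw [mul_smul] at h1
        rw [divPairing_smul, mul_left_comm, abs_mul, abs_of_pos (inv_pos.2 hMpos),
          inv_mul_le_iff₀ hMpos] at h1
        linarith)
  choose μ₁ μ₂ h₁ h₂ hμ using hrep
  -- The order μ₂ - μ₁ absorbs the minus sign in the integration by parts formula.
  let ν : VectorMeasure (Rn n) (Rn n) :=
    ∑ i, ((μ₂ i).withDensityᵥ (fun _ => e i) - (μ₁ i).withDensityᵥ fun _ => e i)
  have hfin₁ : ∀ i, IsFiniteMeasure ((μ₁ i).withDensityᵥ fun _ => e i).variation := fun i => by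
    rw [Measure.variation_withDensityᵥ (integrable_const _)]
    exact isFiniteMeasure_withDensity (by
      simpa using ENNReal.mul_ne_top enorm_ne_top (measure_ne_top _ _))
  have hfin₂ : ∀ i, IsFiniteMeasure ((μ₂ i).withDensityᵥ fun _ => e i).variation := fun i => by
    rw [Measure.variation_withDensityᵥ (integrable_const _)]
    exact isFiniteMeasure_withDensity (by
      simpa using ENNReal.mul_ne_top enorm_ne_top (measure_ne_top _ _))
  have hfin : ∀ i, IsFiniteMeasure
      ((μ₂ i).withDensityᵥ (fun _ => e i) - (μ₁ i).withDensityᵥ fun _ => e i).variation := fun i =>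
    isFiniteMeasure_of_le _ VectorMeasure.variation_sub_le
  have hνfin : IsFiniteMeasure ν.variation := isFiniteMeasure_of_le
    (∑ i, ((μ₂ i).withDensityᵥ (fun _ => e i) - (μ₁ i).withDensityᵥ fun _ => e i).variation)
    (VectorMeasure.variation_finsetSum_le _ _)
  refine ⟨ν, hνfin, fun φ hφ hc => ?_⟩
  have hcomp : ∀ i, ContDiff ℝ ∞ fun x => φ x i := fun i =>
    (EuclideanSpace.proj (𝕜 := ℝ) i).contDiff.comp hφ
  have hcompc : ∀ i, HasCompactSupport fun x => φ x i := fun i =>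
    hc.comp_left (g := fun v : Rn n => v i) rfl
  have hIφ : ∀ (m : VectorMeasure (Rn n) (Rn n)) [IsFiniteMeasure m.variation],
      m.Integrable φ := fun m _ => hφ.continuous.integrable_of_hasCompactSupport hc
  have hsum : φ = fun x => ∑ i, φ x i • e i := by
    ext x j
    simp [e, Pi.single_apply]
  have hint : ∀ (m : Measure (Rn n)) [IsFiniteMeasure m] (i : Fin n)
      [IsFiniteMeasure (m.withDensityᵥ fun _ => e i).variation],
      (m.withDensityᵥ fun _ => e i).integral φ (innerSL ℝ) = ∫ x, φ x i ∂m := by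
    intro m _ i _
    rw [integral_withDensityᵥ (integrable_const _) _ (hIφ _)]
    congr 1; ext x
    rw [innerSL_apply_apply]
    simp [e, EuclideanSpace.inner_single_right]
  rw [VectorMeasure.integral_finsetSum_vectorMeasure (fun i _ => hIφ _), ← Finset.sum_neg_distrib,
    hT hφ hc]
  have hdiv : divPairing α f φ = ∑ i, divPairing α f fun x => φ x i • e i := by
    unfold divPairing
    rw [← integral_finsetSum _ fun i _ => integrable_divPairing (q := q) hα0 hf.1
      (hsm i (hcomp i)).continuous (hbes (hsm i (hcomp i)) (hcs i (hcompc i)))]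
    congr 1; ext z
    rw [← Finset.mul_sum, ← inner_sum, Finset.sum_sub_distrib]
    conv_lhs => rw [hsum]
  rw [hdiv, Finset.mul_sum]
  refine Finset.sum_congr rfl fun i _ => ?_
  rw [VectorMeasure.integral_sub_vectorMeasure (hIφ _) (hIφ _), hint, hint,
    hμ i _ (hcomp i) (hcompc i)]
  ring

theorem IsFracVarMeasure.eq {f : Rn n → ℝ} {ν ν' : VectorMeasure (Rn n) (Rn n)}
    (h : IsFracVarMeasure α f ν) (h' : IsFracVarMeasure α f ν') : ν = ν' := by
  have := h.1
  have := h'.1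
  have : IsFiniteMeasure (ν - ν').variation :=
    isFiniteMeasure_of_le _ VectorMeasure.variation_sub_le
  rw [← sub_eq_zero]
  refine eq_zero_of_integral_test_eq_zero _ fun φ hφ hc => ?_
  have hI : ∀ (m : VectorMeasure (Rn n) (Rn n)) [IsFiniteMeasure m.variation],
      m.Integrable φ := fun m _ => hφ.continuous.integrable_of_hasCompactSupport hc
  rw [VectorMeasure.integral_sub_vectorMeasure (hI _) (hI _), sub_eq_zero]
  exact neg_injective ((h.2 φ hφ hc).symm.trans (h'.2 φ hφ hc))

theorem isFracVarMeasure_fracD {f : Rn n → ℝ} (h : ∃ ν, IsFracVarMeasure α f ν) :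
    IsFracVarMeasure α f (fracD α f) := by
  rw [fracD, dif_pos h]
  exact h.choose_spec

/-- The pairing is at most a constant times the total variation of ν. This gives BV membership of fg
once a measure for it has been exhibited. -/
theorem fracVariation_lt_top_of_isFracVarMeasure {f : Rn n → ℝ}
    {ν : VectorMeasure (Rn n) (Rn n)} (h : IsFracVarMeasure α f ν) : fracVariation α f < ⊤ := by
  have := h.1
  refine lt_of_le_of_lt (b := ENNReal.ofReal (‖(innerSL ℝ : Rn n →L[ℝ] Rn n →L[ℝ] ℝ)‖ *
    ν.variation.real Set.univ)) ?_ ENNReal.ofReal_lt_top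
  refine iSup₂_le fun φ hφ => iSup₂_le fun hc h1 => ENNReal.ofReal_le_ofReal ?_
  rw [h.2 φ hφ hc]
  refine (neg_le_abs _).trans ?_
  refine (VectorMeasure.norm_integral_le_integral_norm (μ := ν) (f := φ) (B := innerSL ℝ)).trans ?_
  gcongr
  refine (integral_mono (μ := ν.variation) (g := fun _ => 1) ?_ (integrable_const _) h1).trans ?_
  · exact (hφ.continuous.integrable_of_hasCompactSupport hc).norm
  · simp

/-- Test with η_k e, where η_k is a cutoff dilated by k + 1. The measure side tends to -⟨e, ν(ℝⁿ)⟩;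
the pairing tends to 0, since the increments of η_k do and f in L^1 allows domination. -/
theorem univ_eq_zero_of_isFracVarMeasure (hn : 1 ≤ n) (hα0 : 0 < α) (hα1 : α < 1)
    {f : Rn n → ℝ} (hf : Integrable f) {ν : VectorMeasure (Rn n) (Rn n)}
    (h : IsFracVarMeasure α f ν) : ν Set.univ = 0 := by
  have := h.1
  have : ENNReal.HolderConjugate 1 ⊤ := inferInstance
  have hf1 : MemLp f 1 := memLp_one_iff_integrable.2 hf
  refine ext_inner_left ℝ fun e => ?_
  let χ : ContDiffBump (0 : Rn n) := ⟨1, 2, one_pos, one_lt_two⟩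
  obtain ⟨L, hL⟩ := ContDiff.lipschitzWith_of_hasCompactSupport (𝕂 := ℝ) χ.hasCompactSupport
    (χ.contDiff (n := 1)) one_ne_zero
  let η : ℕ → Rn n → ℝ := fun k x => χ (((k : ℝ) + 1)⁻¹ • x)
  have hη0 : ∀ k x, 0 ≤ η k x := fun k x => χ.nonneg
  have hη1 : ∀ k x, η k x ≤ 1 := fun k x => χ.le_one
  have hηs : ∀ k, ContDiff ℝ ∞ (η k) := fun k => χ.contDiff.comp (contDiff_const_smul _)
  have hηc : ∀ k, HasCompactSupport (η k) := fun k =>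
    χ.hasCompactSupport.comp_smul (by positivity)
  have hηlim : ∀ x, Tendsto (fun k => η k x) atTop (𝓝 1) := by
    intro x
    refine tendsto_const_nhds.congr' ?_
    filter_upwards [eventually_ge_atTop ⌈‖x‖⌉₊] with k hk
    refine (χ.one_of_mem_closedBall ?_).symm
    have hk' : ‖x‖ ≤ k := Nat.ceil_le.1 hk
    rw [mem_closedBall_zero_iff, norm_smul, norm_inv, Real.norm_of_nonneg (by positivity)]
    change ((k : ℝ) + 1)⁻¹ * ‖x‖ ≤ 1
    rw [inv_mul_le_iff₀ (by positivity)]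
    linarith
  -- Uniform in k: dilation by k + 1 ≥ 1 does not increase the Lipschitz constant, and the added 1
  -- covers |y| ≥ 1, where 0 ≤ η_k ≤ 1 is used.
  have hηinc : ∀ k x y, |η k (x + y) - η k x| ≤ (L + 1) * min ‖y‖ 1 := by
    intro k x y
    rcases le_total ‖y‖ 1 with hy | hy
    · rw [min_eq_left hy]
      have h1 := hL.norm_sub_le (((k : ℝ) + 1)⁻¹ • (x + y)) (((k : ℝ) + 1)⁻¹ • x)
      rw [← smul_sub, add_sub_cancel_left, norm_smul, norm_inv,
        Real.norm_of_nonneg (show 0 ≤ (k : ℝ) + 1 by positivity)] at h1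
      have h2 : ((k : ℝ) + 1)⁻¹ ≤ 1 := inv_le_one_of_one_le₀ (by linarith [(k.cast_nonneg : (0:ℝ) ≤ k)])
      calc |η k (x + y) - η k x| ≤ L * (((k : ℝ) + 1)⁻¹ * ‖y‖) := h1
        _ ≤ (L + 1) * (1 * ‖y‖) := by gcongr; linarith
        _ = _ := by ring
    · rw [min_eq_right hy, mul_one, abs_le]
      have hL0 : (0 : ℝ) ≤ L := L.2
      constructor <;> linarith [hη0 k x, hη1 k x, hη0 k (x + y), hη1 k (x + y)]
  let φ : ℕ → Rn n → Rn n := fun k x => η k x • e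
  have hφs : ∀ k, ContDiff ℝ ∞ (φ k) := fun k => (hηs k).smul contDiff_const
  have hφc : ∀ k, HasCompactSupport (φ k) := fun k => (hηc k).smul_right
  have hform : ∀ k, fracConst n α * divPairing α f (φ k) = -ν.integral (φ k) (innerSL ℝ) := by
    intro k
    rw [← h.2 _ (hφs k) (hφc k), integral_mul_fracDiv (p := 1) (q := ⊤) hα0 hf1
      (hφs k).continuous (besovIntegral_lt_top_of_test hn hα0 hα1 le_top (hφs k) (hφc k))]
  have hlim1 : Tendsto (fun k => divPairing α f (φ k)) atTop (𝓝 0) := by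
    have hbound : Integrable (fun z : Rn n × Rn n =>
        (|f z.1| * (‖e‖ * (L + 1))) * (min ‖z.2‖ 1 * rieszWeight n α z.2))
        (volume.prod volume) :=
      (hf.abs.mul_const _).mul_prod (integrable_min_mul_rieszWeight hn hα0 hα1)
    have h0 : (0 : ℝ) = ∫ z : Rn n × Rn n, 0 ∂(volume.prod volume) := by simp
    rw [h0]
    refine tendsto_integral_of_dominated_convergence _ (fun k => ?_) hbound (fun k => ?_) ?_
    · exact hf.1.comp_fst.mul (aestronglyMeasurable_inner_increment (hφs k).continuous _)
    · refine Eventually.of_forall fun z => ?_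
      rw [norm_mul, Real.norm_eq_abs (f z.1), mul_assoc]
      gcongr
      refine (abs_inner_rieszKernel_le hα0 _ _).trans ?_
      change ‖η k (z.1 + z.2) • e - η k z.1 • e‖ * _ ≤ _
      rw [← sub_smul, norm_smul, Real.norm_eq_abs, ← mul_assoc]
      refine mul_le_mul_of_nonneg_right ?_ (rieszWeight_nonneg _)
      calc |η k (z.1 + z.2) - η k z.1| * ‖e‖ ≤ (L + 1) * min ‖z.2‖ 1 * ‖e‖ := by
            gcongr; exact hηinc k _ _
        _ = _ := by ring
    · refine Eventually.of_forall fun z => ?_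
      have h1 : Tendsto (fun k => φ k (z.1 + z.2) - φ k z.1) atTop (𝓝 ((1 : ℝ) • e - (1 : ℝ) • e)) :=
        ((hηlim _).smul_const e).sub ((hηlim _).smul_const e)
      rw [sub_self] at h1
      have h2 := (tendsto_const_nhds (x := f z.1)).mul
        ((tendsto_const_nhds (x := rieszKernel n α z.2)).inner (𝕜 := ℝ) h1)
      rwa [inner_zero_right, mul_zero] at h2
  have hlim2 : Tendsto (fun k => ν.integral (φ k) (innerSL ℝ)) atTop
      (𝓝 (ν.integral (fun _ => e) (innerSL ℝ))) := by
    refine VectorMeasure.tendsto_integral_filter_of_norm_le_const (Eventually.of_forall fun k =>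
      (hφs k).continuous.aestronglyMeasurable) ⟨‖e‖, Eventually.of_forall fun k =>
      Eventually.of_forall fun x => ?_⟩ (Eventually.of_forall fun x => ?_)
    · change ‖η k x • e‖ ≤ ‖e‖
      rw [norm_smul, Real.norm_of_nonneg (hη0 k x)]
      exact mul_le_of_le_one_left (norm_nonneg _) (hη1 k x)
    · simpa using (hηlim x).smul_const e
  have h3 := tendsto_nhds_unique (hlim1.const_mul (fracConst n α))
    (hlim2.neg.congr fun k => (hform k).symm)
  rw [VectorMeasure.integral_const, innerSL_apply_apply, mul_zero] at h3
  rw [inner_zero_right]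
  linarith

end FracBV

end VariationMeasure

/-! ### The Leibniz rule -/

noncomputable section Leibniz

open Filter Topology

namespace FracBV

variable {n : ℕ} {α : ℝ} {p q : ℝ≥0∞}

/-- Interpolation by t^r ≤ t + t^p for finite p, and |u|^r ≤ ‖u‖_∞^{r-1} |u| for p = ∞. -/
theorem memLp_of_memLp_one_of_le {u : Rn n → ℝ} {r : ℝ≥0∞} (h1 : MemLp u 1) (hp : MemLp u p)
    (hr : 1 ≤ r) (hrp : r ≤ p) : MemLp u r := by
  rcases eq_or_ne r ⊤ with rfl | hrt
  · rwa [top_le_iff.1 hrp] at hp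
  have hr0 : r ≠ 0 := (zero_lt_one.trans_le hr).ne'
  have hr1 : 1 ≤ r.toReal := by
    simpa using ENNReal.toReal_mono hrt hr
  have hfin1 : ∫⁻ x, ‖u x‖ₑ < ⊤ := (memLp_one_iff_integrable.1 h1).2
  refine ⟨h1.1, (eLpNorm_lt_top_iff_lintegral_rpow_enorm_lt_top hr0 hrt).2 ?_⟩
  rcases eq_or_ne p ⊤ with rfl | hpt
  · have hN : eLpNorm u ⊤ volume ≠ ⊤ := hp.2.ne
    calc ∫⁻ x, ‖u x‖ₑ ^ r.toReal
        ≤ ∫⁻ x, eLpNorm u ⊤ volume ^ (r.toReal - 1) * ‖u x‖ₑ := by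
          refine lintegral_mono_ae ?_
          filter_upwards [ae_le_eLpNormEssSup (f := u) (μ := volume)] with x hx
          calc ‖u x‖ₑ ^ r.toReal = ‖u x‖ₑ ^ (r.toReal - 1) * ‖u x‖ₑ := by
                nth_rewrite 3 [← ENNReal.rpow_one ‖u x‖ₑ]
                rw [← ENNReal.rpow_add_of_nonneg _ _ (by linarith) zero_le_one, sub_add_cancel]
            _ ≤ _ := by
                gcongr
                rw [eLpNorm_exponent_top]; exact hx
      _ = eLpNorm u ⊤ volume ^ (r.toReal - 1) * ∫⁻ x, ‖u x‖ₑ :=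
          lintegral_const_mul' _ _ (ENNReal.rpow_ne_top_of_nonneg (by linarith) hN)
      _ < ⊤ := ENNReal.mul_lt_top
          (ENNReal.rpow_lt_top_of_nonneg (by linarith) hN) hfin1
  · have hp0 : p ≠ 0 := (zero_lt_one.trans_le (hr.trans hrp)).ne'
    have hfinp := (eLpNorm_lt_top_iff_lintegral_rpow_enorm_lt_top hp0 hpt).1 hp.2
    calc ∫⁻ x, ‖u x‖ₑ ^ r.toReal ≤ ∫⁻ x, (‖u x‖ₑ + ‖u x‖ₑ ^ p.toReal) := by
          refine lintegral_mono fun x => ?_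
          rcases le_total ‖u x‖ₑ 1 with h | h
          · refine le_add_right ?_
            simpa using ENNReal.rpow_le_rpow_of_exponent_ge h hr1
          · exact le_add_left (ENNReal.rpow_le_rpow_of_exponent_le h
              (ENNReal.toReal_mono hpt hrp))
      _ = (∫⁻ x, ‖u x‖ₑ) + ∫⁻ x, ‖u x‖ₑ ^ p.toReal := lintegral_add_left' h1.1.enorm _
      _ < ⊤ := ENNReal.add_lt_top.2 ⟨hfin1, hfinp⟩

/-- The involution `(x, h) ↦ (x + h, -h)`, which exchanges `x` and `x + h`. -/
def incrementSwap (n : ℕ) : Rn n × Rn n ≃ᵐ Rn n × Rn n where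
  toFun z := (z.1 + z.2, -z.2)
  invFun z := (z.1 + z.2, -z.2)
  left_inv z := by simp
  right_inv z := by simp
  measurable_toFun := by
    change Measurable fun z : Rn n × Rn n => (z.1 + z.2, -z.2)
    fun_prop
  measurable_invFun := by
    change Measurable fun z : Rn n × Rn n => (z.1 + z.2, -z.2)
    fun_prop

theorem measurePreserving_incrementSwap :
    MeasurePreserving (incrementSwap n) (volume.prod volume) (volume.prod volume) :=
  ((MeasurePreserving.id volume).prod (Measure.measurePreserving_neg volume)).comp
    (measurePreserving_add_prod (volume : Measure (Rn n)) volume)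

/-- The swap preserves measure, so the integral equals its own negative; a divergent integral has
the default value 0 anyway. -/
theorem integral_eq_zero_of_swap_neg {E : Type*} [NormedAddCommGroup E] [NormedSpace ℝ E]
    (G : Rn n × Rn n → E) (hG : ∀ x h, G (x + h, -h) = -G (x, h)) :
    ∫ z, G z ∂(volume.prod volume) = 0 := by
  have h1 := (measurePreserving_incrementSwap (n := n)).integral_comp
    (incrementSwap n).measurableEmbedding G
  have h2 : ∫ z, G (incrementSwap n z) ∂(volume.prod volume) =
      -∫ z, G z ∂(volume.prod volume) := by
    rw [← integral_neg]
    exact integral_congr_ae (Eventually.of_forall fun z => hG z.1 z.2)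
  rw [h2] at h1
  have h3 : (2 : ℝ) • ∫ z, G z ∂(volume.prod volume) = 0 := by
    rw [two_smul]
    nth_rewrite 1 [← h1]
    exact neg_add_cancel _
  exact (smul_eq_zero.1 h3).resolve_left two_ne_zero

theorem integral_inner_fst {G : Rn n × Rn n → Rn n} (hG : Integrable G (volume.prod volume))
    {φ : Rn n → Rn n} (hφ : Continuous φ) {M : ℝ} (hM : ∀ x, ‖φ x‖ ≤ M) :
    Integrable (fun z => (inner ℝ (φ z.1) (G z) : ℝ)) (volume.prod volume) ∧
    ∫ z, (inner ℝ (φ z.1) (G z) : ℝ) ∂(volume.prod volume) =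
      ∫ x, inner ℝ (φ x) (∫ h, G (x, h)) := by
  have hI : Integrable (fun z => (inner ℝ (φ z.1) (G z) : ℝ)) (volume.prod volume) := by
    refine (hG.norm.const_mul M).mono'
      ((hφ.comp continuous_fst).aestronglyMeasurable.inner hG.1) (Eventually.of_forall fun z => ?_)
    exact (norm_inner_le_norm _ _).trans (mul_le_mul_of_nonneg_right (hM _) (norm_nonneg _))
  refine ⟨hI, ?_⟩
  rw [integral_prod _ hI]
  refine integral_congr_ae ?_
  filter_upwards [hG.prod_right_ae] with x hx
  exact integral_inner hx (φ x)

/-- The increment of gφ is g(x + h) times that of φ plus that of g times φ(x). This makes gφ an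
admissible test field for D^α f. -/
theorem besovIntegral_smul_lt_top (hq : 1 ≤ q) {g : Rn n → ℝ} {φ : Rn n → Rn n}
    (hg : Continuous g) (hφ : Continuous φ) {C M : ℝ} (hC : ∀ x, |g x| ≤ C)
    (hM : ∀ x, ‖φ x‖ ≤ M) (hbg : besovIntegral α q g < ⊤) (hbφ : besovIntegral α q φ < ⊤) :
    besovIntegral α q (fun x => g x • φ x) < ⊤ := by
  have hC0 : 0 ≤ C := (abs_nonneg _).trans (hC 0)
  have hM0 : 0 ≤ M := (norm_nonneg _).trans (hM 0)
  have hle : ∀ h, eLpNorm (fun x => g (x + h) • φ (x + h) - g x • φ x) q volume ≤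
      ENNReal.ofReal C * eLpNorm (fun x => φ (x + h) - φ x) q volume +
        ENNReal.ofReal M * eLpNorm (fun x => g (x + h) - g x) q volume := by
    intro h
    have hd : (fun x => g (x + h) • φ (x + h) - g x • φ x) =
        (fun x => g (x + h) • (φ (x + h) - φ x)) + fun x => (g (x + h) - g x) • φ x := by
      ext x : 1
      simp only [Pi.add_apply]
      module
    rw [hd]
    refine (eLpNorm_add_le (Continuous.aestronglyMeasurable (by fun_prop))
      (Continuous.aestronglyMeasurable (by fun_prop)) hq).trans (add_le_add ?_ ?_)
    · refine eLpNorm_le_mul_eLpNorm_of_ae_le_mul (Eventually.of_forall fun x => ?_) q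
      rw [norm_smul]
      exact mul_le_mul_of_nonneg_right (hC _) (norm_nonneg _)
    · refine eLpNorm_le_mul_eLpNorm_of_ae_le_mul (Eventually.of_forall fun x => ?_) q
      rw [norm_smul, mul_comm]
      exact mul_le_mul_of_nonneg_right (hM _) (norm_nonneg _)
  calc besovIntegral α q (fun x => g x • φ x)
      ≤ ∫⁻ h, (ENNReal.ofReal C * (eLpNorm (fun x => φ (x + h) - φ x) q volume *
          ENNReal.ofReal (rieszWeight n α h)) + ENNReal.ofReal M *
          (eLpNorm (fun x => g (x + h) - g x) q volume * ENNReal.ofReal (rieszWeight n α h))) := by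
        refine lintegral_mono fun h => ?_
        dsimp only
        rw [← mul_assoc, ← mul_assoc, ← add_mul]
        gcongr
        exact hle h
    _ = ENNReal.ofReal C * besovIntegral α q φ + ENNReal.ofReal M * besovIntegral α q g := by
        rw [lintegral_add_left ((measurable_besovIntegrand hφ q).const_mul _),
          lintegral_const_mul _ (measurable_besovIntegrand hφ q),
          lintegral_const_mul _ (measurable_besovIntegrand hg q)]
        rfl
    _ < ⊤ := ENNReal.add_lt_top.2 ⟨ENNReal.mul_lt_top ENNReal.ofReal_lt_top hbφ,
        ENNReal.mul_lt_top ENNReal.ofReal_lt_top hbg⟩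

variable [ENNReal.HolderConjugate p q]

theorem integrable_mul_increment_kernel (hα0 : 0 < α) {f g : Rn n → ℝ} (hf : MemLp f p)
    (hg : Continuous g) (hb : besovIntegral α q g < ⊤) :
    Integrable (fun z : Rn n × Rn n => (f z.1 * (g (z.1 + z.2) - g z.1)) • rieszKernel n α z.2)
      (volume.prod volume) := by
  refine (integrable_fst_increment hf hg hb).mono' ?_ (Eventually.of_forall fun z => ?_)
  · exact (hf.1.comp_fst.mul (Continuous.aestronglyMeasurable (by fun_prop))).smul
      (measurable_rieszKernel.comp measurable_snd).aestronglyMeasurable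
  · rw [norm_smul, norm_mul, norm_rieszKernel hα0]

/-- No regularity of f enters: |f(x + h) - f(x)| ≤ |f(x + h)| + |f(x)|, and Hölder handles both
terms. -/
theorem integrable_increment_mul_increment_kernel (hα0 : 0 < α) {f g : Rn n → ℝ}
    (hf : MemLp f p) (hg : Continuous g) (hb : besovIntegral α q g < ⊤) :
    Integrable (fun z : Rn n × Rn n =>
      ((f (z.1 + z.2) - f z.1) * (g (z.1 + z.2) - g z.1)) • rieszKernel n α z.2)
      (volume.prod volume) := by
  refine ((integrable_shift_increment hf hg hb).add (integrable_fst_increment hf hg hb)).mono' ?_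
    (Eventually.of_forall fun z => ?_)
  · have h1 : AEStronglyMeasurable (fun z : Rn n × Rn n => f (z.1 + z.2)) (volume.prod volume) :=
      (hf.1.comp_snd).comp_measurePreserving (measurePreserving_prod_add volume volume)
    exact ((h1.sub hf.1.comp_fst).mul (Continuous.aestronglyMeasurable (by fun_prop))).smul
      (measurable_rieszKernel.comp measurable_snd).aestronglyMeasurable
  · rw [norm_smul, norm_mul, norm_rieszKernel hα0, Pi.add_apply, ← add_mul, ← add_mul]
    gcongr
    · exact rieszWeight_nonneg _
    · exact norm_sub_le _ _

/-- The indicator of a ball lies in L^p; using it in place of f gives the claim almost everywhere on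
the ball, and balls exhaust the space. -/
theorem ae_integrable_gradKernel (p : ℝ≥0∞) [ENNReal.HolderConjugate p q] (hα0 : 0 < α) {g : Rn n → ℝ}
    (hg : Continuous g) (hb : besovIntegral α q g < ⊤) :
    ∀ᵐ x, Integrable (gradKernel α g x) := by
  have key : ∀ k : ℕ, ∀ᵐ x, x ∈ Metric.closedBall (0 : Rn n) k →
      Integrable (gradKernel α g x) := by
    intro k
    have h1 : MemLp ((Metric.closedBall (0 : Rn n) k).indicator fun _ => (1 : ℝ)) p :=
      memLp_indicator_const p Metric.isClosed_closedBall.measurableSet 1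
        (Or.inr (isCompact_closedBall _ _).measure_lt_top.ne)
    filter_upwards [(integrable_mul_increment_kernel hα0 h1 hg hb).prod_right_ae] with x hx hxk
    have h2 := hx.comp_sub_right x
    refine h2.congr (Eventually.of_forall fun y => ?_)
    have h3 := gradKernel_add (α := α) g x (y - x)
    rw [add_sub_cancel] at h3
    simp [h3, hxk]
  filter_upwards [ae_all_iff.2 key] with x hx
  obtain ⟨k, hk⟩ := exists_nat_ge ‖x‖
  exact hx k (by simpa using hk)

theorem ae_integrable_gradNLKernel (hα0 : 0 < α) {f g : Rn n → ℝ} (hf : MemLp f p)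
    (hg : Continuous g) (hb : besovIntegral α q g < ⊤) :
    ∀ᵐ x, Integrable (gradNLKernel α f g x) := by
  filter_upwards [(integrable_increment_mul_increment_kernel hα0 hf hg hb).prod_right_ae] with x hx
  have h2 := hx.comp_sub_right x
  refine h2.congr (Eventually.of_forall fun y => ?_)
  have h3 := gradNLKernel_add (α := α) f g x (y - x)
  rw [add_sub_cancel] at h3
  simp [h3]

theorem smul_fracGrad_eq (f g : Rn n → ℝ) (x : Rn n) :
    f x • fracGrad α g x =
      fracConst n α • ∫ h, (f x * (g (x + h) - g x)) • rieszKernel n α h := by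
  rw [fracGrad_eq, smul_comm, ← integral_smul]
  simp_rw [smul_smul]

theorem integrable_smul_fracGrad (hα0 : 0 < α) {f g : Rn n → ℝ} (hf : MemLp f p)
    (hg : Continuous g) (hb : besovIntegral α q g < ⊤) :
    Integrable (fun x => f x • fracGrad α g x) := by
  simp_rw [smul_fracGrad_eq]
  exact (integrable_mul_increment_kernel hα0 hf hg hb).integral_prod_left.smul (fracConst n α)

theorem integrable_fracGradNL (hα0 : 0 < α) {f g : Rn n → ℝ} (hf : MemLp f p)
    (hg : Continuous g) (hb : besovIntegral α q g < ⊤) :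
    Integrable (fracGradNL α f g) := by
  have h := (integrable_increment_mul_increment_kernel hα0 hf hg hb).integral_prod_left.smul
    (fracConst n α)
  exact h.congr (Eventually.of_forall fun x => (fracGradNL_eq f g x).symm)

theorem integral_fracGradNL (hα0 : 0 < α) {f g : Rn n → ℝ} (hf : MemLp f p)
    (hg : Continuous g) (hb : besovIntegral α q g < ⊤) :
    ∫ x, fracGradNL α f g x = 0 := by
  simp_rw [fracGradNL_eq]
  rw [integral_smul, ← integral_prod _ (integrable_increment_mul_increment_kernel hα0 hf hg hb),
    integral_eq_zero_of_swap_neg, smul_zero]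
  intro x h
  simp only [add_neg_cancel_right, rieszKernel_neg]
  module

/-- The Leibniz rule tested against a smooth vector field. -/
theorem divPairing_mul (hα0 : 0 < α) (hq : 1 ≤ q) {f g : Rn n → ℝ} (hf : MemLp f p)
    (hg : Continuous g) {C : ℝ} (hC : ∀ x, |g x| ≤ C) (hb : besovIntegral α q g < ⊤)
    {φ : Rn n → Rn n} (hφ : Continuous φ) {M : ℝ} (hM : ∀ x, ‖φ x‖ ≤ M)
    (hbφ : besovIntegral α q φ < ⊤) :
    fracConst n α * divPairing α (fun x => f x * g x) φ =
      fracConst n α * divPairing α f (fun x => g x • φ x) -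
        (∫ x, inner ℝ (φ x) (f x • fracGrad α g x)) -
        ∫ x, inner ℝ (φ x) (fracGradNL α f g x) := by
  have hbgφ := besovIntegral_smul_lt_top hq hg hφ hC hM hb hbφ
  have hcgφ : Continuous fun x => g x • φ x := hg.smul hφ
  have hG := integrable_mul_increment_kernel hα0 hf hg hb
  have hN := integrable_increment_mul_increment_kernel hα0 hf hg hb
  obtain ⟨hG1, hG2⟩ := integral_inner_fst hG hφ hM
  obtain ⟨hN1, hN2⟩ := integral_inner_fst hN hφ hM
  have hP := integrable_divPairing hα0 hf hcgφ hbgφ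
  simp_rw [smul_fracGrad_eq, fracGradNL_eq, inner_smul_right]
  rw [integral_const_mul, integral_const_mul, ← mul_sub, ← mul_sub]
  congr 1
  rw [← hG2, ← hN2]
  unfold divPairing
  have hfg : AEStronglyMeasurable (fun z : Rn n × Rn n => (f z.1 * g z.1) *
      (inner ℝ (rieszKernel n α z.2) (φ (z.1 + z.2) - φ z.1) : ℝ)) (volume.prod volume) :=
    (hf.1.comp_fst.mul (hg.comp continuous_fst).aestronglyMeasurable).mul
      (aestronglyMeasurable_inner_increment hφ _)
  have hfgI : Integrable (fun z : Rn n × Rn n => (f z.1 * g z.1) *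
      (inner ℝ (rieszKernel n α z.2) (φ (z.1 + z.2) - φ z.1) : ℝ)) (volume.prod volume) := by
    refine ((integrable_divPairing hα0 hf hφ hbφ).norm.const_mul C).mono' hfg
      (Eventually.of_forall fun z => ?_)
    rw [norm_mul, norm_mul, norm_mul]
    calc ‖f z.1‖ * ‖g z.1‖ * _ ≤ ‖f z.1‖ * C * _ := by gcongr; exact hC _
      _ = _ := by ring
  rw [← sub_eq_zero, ← integral_sub' hP hG1, ← integral_sub' (hP.sub hG1) hN1,
    ← integral_sub' hfgI ((hP.sub hG1).sub hN1)]
  -- The terms collect to K(h)·(g(x) - g(x+h))(f(x) φ(x+h) - f(x+h) φ(x)): the second factor is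
  -- swap-invariant and K is odd.
  refine integral_eq_zero_of_swap_neg _ fun x h => ?_
  simp only [Pi.sub_apply, add_neg_cancel_right, rieszKernel_neg, inner_neg_left, inner_neg_right,
    inner_sub_right, inner_smul_right, real_inner_comm (rieszKernel n α h)]
  ring

theorem MemLp.mul_bounded {f g : Rn n → ℝ} (hf : MemLp f p) (hg : Continuous g) {C : ℝ}
    (hC : ∀ x, |g x| ≤ C) : MemLp (fun x => f x * g x) p :=
  hf.of_le_mul (c := C) (hf.1.mul hg.aestronglyMeasurable) (Eventually.of_forall fun x => by
    rw [norm_mul, mul_comm]; exact mul_le_mul_of_nonneg_right (hC x) (norm_nonneg _))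

theorem isFiniteMeasure_variation_withDensityᵥ {μ : Measure (Rn n)} {σ : Rn n → Rn n}
    (hσ : Integrable σ μ) : IsFiniteMeasure (μ.withDensityᵥ σ).variation := by
  rw [Measure.variation_withDensityᵥ hσ]
  exact isFiniteMeasure_withDensity hσ.2.ne

theorem integrable_of_memCb (ν : VectorMeasure (Rn n) (Rn n)) [IsFiniteMeasure ν.variation]
    {g : Rn n → ℝ} (hg : Continuous g) {C : ℝ} (hC : ∀ x, |g x| ≤ C) : ν.Integrable g :=
  Integrable.of_bound hg.aestronglyMeasurable C (Eventually.of_forall hC)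

theorem isFiniteMeasure_variation_withDensity (ν : VectorMeasure (Rn n) (Rn n))
    [IsFiniteMeasure ν.variation] {g : Rn n → ℝ} (hg : ν.Integrable g) :
    IsFiniteMeasure (ν.withDensity g (ContinuousLinearMap.lsmul ℝ ℝ)).variation := by
  obtain ⟨σ, hσ, hν⟩ := exists_eq_withDensityᵥ ν
  generalize ν.variation = m at hσ hν
  subst hν
  rw [withDensity_withDensityᵥ hσ hg]
  exact isFiniteMeasure_variation_withDensityᵥ (by
    simpa using integrable_bilin_of_variation hσ (ContinuousLinearMap.lsmul ℝ ℝ) hg)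

theorem integral_withDensity_test (ν : VectorMeasure (Rn n) (Rn n))
    [IsFiniteMeasure ν.variation] {g : Rn n → ℝ} (hg : Continuous g) {C : ℝ}
    (hC : ∀ x, |g x| ≤ C) {φ : Rn n → Rn n} (hφ : Continuous φ) (hc : HasCompactSupport φ) :
    (ν.withDensity g (ContinuousLinearMap.lsmul ℝ ℝ)).integral φ (innerSL ℝ) =
      ν.integral (fun x => g x • φ x) (innerSL ℝ) := by
  have hgν := integrable_of_memCb ν hg hC
  have hfin := isFiniteMeasure_variation_withDensity ν hgν
  have h1 : (ν.withDensity g (ContinuousLinearMap.lsmul ℝ ℝ)).Integrable φ :=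
    hφ.integrable_of_hasCompactSupport hc
  have h2 : ν.Integrable fun x => g x • φ x :=
    (hg.smul hφ).integrable_of_hasCompactSupport hc.smul_left
  obtain ⟨σ, hσ, hν⟩ := exists_eq_withDensityᵥ ν
  generalize ν.variation = m at hσ hν
  subst hν
  have hi : Integrable (fun x => g x • σ x) m := by
    simpa using integrable_bilin_of_variation hσ (ContinuousLinearMap.lsmul ℝ ℝ) hgν
  rw [withDensity_withDensityᵥ hσ hgν] at h1 ⊢
  rw [integral_withDensityᵥ hi _ h1, integral_withDensityᵥ hσ _ h2]
  congr 1; ext x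
  rw [innerSL_apply_apply, innerSL_apply_apply, inner_smul_left, inner_smul_right]
  rfl

/-- The right-hand side of the Leibniz rule is a fractional variation measure of the product. -/
theorem isFracVarMeasure_mul (hn : 1 ≤ n) (hα0 : 0 < α) (hα1 : α < 1) (hp : 1 ≤ p) (hq : 1 ≤ q)
    {f g : Rn n → ℝ} (hf : MemLp f p) (hg : Continuous g) {C : ℝ} (hC : ∀ x, |g x| ≤ C)
    (hb : besovIntegral α q g < ⊤) {ν : VectorMeasure (Rn n) (Rn n)}
    (hν : IsFracVarMeasure α f ν) :
    IsFracVarMeasure α (fun x => f x * g x)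
      (ν.withDensity g (ContinuousLinearMap.lsmul ℝ ℝ) +
        (volume : Measure (Rn n)).withDensityᵥ (fun x => f x • fracGrad α g x) +
        (volume : Measure (Rn n)).withDensityᵥ (fracGradNL α f g)) := by
  have h0 := hν.1
  have hI1 := integrable_smul_fracGrad hα0 hf hg hb
  have hI2 := integrable_fracGradNL hα0 hf hg hb
  have f0 := isFiniteMeasure_variation_withDensity ν (integrable_of_memCb ν hg hC)
  have f1 := isFiniteMeasure_variation_withDensityᵥ hI1
  have f2 := isFiniteMeasure_variation_withDensityᵥ hI2
  have f3 : IsFiniteMeasure (ν.withDensity g (ContinuousLinearMap.lsmul ℝ ℝ) +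
        (volume : Measure (Rn n)).withDensityᵥ (fun x => f x • fracGrad α g x)).variation :=
    isFiniteMeasure_of_le _ VectorMeasure.variation_add_le
  refine ⟨isFiniteMeasure_of_le _ VectorMeasure.variation_add_le, fun φ hφ hc => ?_⟩
  have hIφ : ∀ (m : VectorMeasure (Rn n) (Rn n)) [IsFiniteMeasure m.variation],
      m.Integrable φ := fun m _ => hφ.continuous.integrable_of_hasCompactSupport hc
  obtain ⟨M, hM⟩ := hφ.continuous.bounded_above_of_compact_support hc
  have hbφ : besovIntegral α q φ < ⊤ := besovIntegral_lt_top_of_test hn hα0 hα1 hq hφ hc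
  have e1 := integral_mul_fracDiv (q := q) hα0 (MemLp.mul_bounded hf hg hC) hφ.continuous hbφ
  have e2 := divPairing_mul hα0 hq hf hg hC hb hφ.continuous hM hbφ
  have hcψ : Continuous fun x => g x • φ x := hg.smul hφ.continuous
  have hsψ : HasCompactSupport fun x => g x • φ x := hc.smul_left (f := g)
  have hbψ := besovIntegral_smul_lt_top hq hg hφ.continuous hC hM hb hbφ
  -- gφ need not be smooth, so the extended integration by parts formula is needed here.
  have e3 := divPairing_eq_integral_of_continuous (q := q) hp hn hα0 hα1 hq hf hν hcψ hsψ hbψ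
  have e4 := integral_withDensity_test ν hg hC hφ.continuous hc
  have e5 : _ = ∫ x, (inner ℝ (φ x) (f x • fracGrad α g x) : ℝ) :=
    integral_withDensityᵥ hI1 (innerSL ℝ) (hIφ _)
  have e6 : _ = ∫ x, (inner ℝ (φ x) (fracGradNL α f g x) : ℝ) :=
    integral_withDensityᵥ hI2 (innerSL ℝ) (hIφ _)
  rw [VectorMeasure.integral_add_vectorMeasure (hIφ _) (hIφ _),
    VectorMeasure.integral_add_vectorMeasure (hIφ _) (hIφ _), e1, e2, e3, e4, e5, e6]
  ring

end FracBV

end Leibniz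

theorem theorem3p1 (n : ℕ) (hn : 1 ≤ n) (α : ℝ) (hα0 : 0 < α) (hα1 : α < 1)
    (p q : ℝ≥0∞) (hp : 1 ≤ p) (hq : 1 ≤ q) (hpq : 1 / p + 1 / q = 1)
    (f g : EuclideanSpace ℝ (Fin n) → ℝ)
    (hf : FracBV.MemBV α p f) (hgc : FracBV.MemCb g) (hg : FracBV.MemBesov α q 1 g) :
    -- the product lies in all the spaces
    (∀ r : ℝ≥0∞, 1 ≤ r → r ≤ p → FracBV.MemBV α r (fun x => f x * g x)) ∧
    -- all the objects in the formulas below are well defined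
    FracBV.IsFracVarMeasure α f (FracBV.fracD α f) ∧
    FracBV.IsFracVarMeasure α (fun x => f x * g x) (FracBV.fracD α (fun x => f x * g x)) ∧
    (∀ᵐ x, Integrable (FracBV.gradKernel α g x)) ∧
    (∀ᵐ x, Integrable (FracBV.gradNLKernel α f g x)) ∧
    (FracBV.fracD α f).Integrable g ∧
    Integrable (fun x => f x • FracBV.fracGrad α g x) ∧
    Integrable (FracBV.fracGradNL α f g) ∧
    -- the Leibniz rule
    FracBV.fracD α (fun x => f x * g x) =
      (FracBV.fracD α f).withDensity g (ContinuousLinearMap.lsmul ℝ ℝ) +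
        (volume : Measure (EuclideanSpace ℝ (Fin n))).withDensityᵥ
          (fun x => f x • FracBV.fracGrad α g x) +
        (volume : Measure (EuclideanSpace ℝ (Fin n))).withDensityᵥ (FracBV.fracGradNL α f g) ∧
    -- zero total mass and zero mean
    FracBV.fracD α (fun x => f x * g x) Set.univ = 0 ∧
    (∫ x, FracBV.fracGradNL α f g x) = 0 ∧
    -- integration by parts
    (∫ x, f x • FracBV.fracGrad α g x) =
      - (FracBV.fracD α f).integral g (ContinuousLinearMap.lsmul ℝ ℝ) := by
  have hconj : ENNReal.HolderConjugate p q :=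
    ⟨by rw [← one_div, ← one_div, hpq, inv_one]⟩
  obtain ⟨hgcont, C, hC⟩ := hgc
  have hb : FracBV.besovIntegral α q g < ⊤ := by
    rw [← FracBV.besovSeminorm_one_eq hα0]; exact hg.2
  have hD := FracBV.isFracVarMeasure_fracD
    (FracBV.exists_isFracVarMeasure (q := q) hn hα0 hα1 hq hf)
  have hprod := FracBV.isFracVarMeasure_mul hn hα0 hα1 hp hq hf.1 hgcont hC hb hD
  -- D^α(fg) exists because the Leibniz right-hand side is a witness, before BV membership of fg is
  -- known.
  have hDfg := FracBV.isFracVarMeasure_fracD ⟨_, hprod⟩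
  have hfg1 : MemLp (fun x => f x * g x) 1 := hg.1.mul' hf.1
  have hLp := FracBV.MemLp.mul_bounded hf.1 hgcont hC
  have hI1 := FracBV.integrable_smul_fracGrad hα0 hf.1 hgcont hb
  have hI2 := FracBV.integrable_fracGradNL hα0 hf.1 hgcont hb
  have hzero := FracBV.univ_eq_zero_of_isFracVarMeasure hn hα0 hα1
    (memLp_one_iff_integrable.1 hfg1) hDfg
  have hNL := FracBV.integral_fracGradNL hα0 hf.1 hgcont hb
  have hfin := hD.1
  have hleib := hDfg.eq hprod
  refine ⟨fun r hr hrp => ⟨FracBV.memLp_of_memLp_one_of_le hfg1 hLp hr hrp,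
    FracBV.fracVariation_lt_top_of_isFracVarMeasure hDfg⟩, hD, hDfg,
    FracBV.ae_integrable_gradKernel p hα0 hgcont hb,
    FracBV.ae_integrable_gradNLKernel hα0 hf.1 hgcont hb,
    FracBV.integrable_of_memCb _ hgcont hC, hI1, hI2, hleib, hzero, hNL, ?_⟩
  -- Evaluate the Leibniz rule on the whole space, where the left side and the non-local term
  -- vanish.
  rw [hleib, add_apply, add_apply,
    withDensityᵥ_apply hI1 MeasurableSet.univ, withDensityᵥ_apply hI2 MeasurableSet.univ,
    VectorMeasure.withDensity_apply_univ, setIntegral_univ, setIntegral_univ, hNL, add_zero]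
    at hzero
  exact eq_neg_of_add_eq_zero_right hzero
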